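/- For real $c>0$ and $g$ with $(c-1)^2>-2g$ put $\Delta=(c-1)^2+2g=c^2-2c+2g+1$, $\phi_1=c-1-\sqrt\Delta$, $\phi_r=c-1+2\sqrt\Delta$, and let $\Gamma=\Gamma_{c,g}$ be the homoclinic loop (to the saddle $(\phi_1,0)$) of the unperturbed system $\phi'=y$, $y'=\frac1c\big[(c-1)\phi-\frac12\phi^2+g\big]$, given by $\phi(\xi)=\phi_r-(\phi_r-\phi_1)\tanh^2\!\big(\tfrac12\sqrt{\tfrac{\phi_r-\phi_1}{3c}}\,\xi\big)$, $y(\xi)=\phi'(\xi)$, $\xi\in\mathbb R$. Consider the planar slow system with Kuramoto–Sivashinsky perturbation $$\phi'=y,\qquad y'=\frac1c\Big[(c-1)\phi-\frac12\phi^2+g\Big]-\tau\,\frac1c\Big(\frac{2c-1}{c}\,y-\frac1c\,\phi y\Big)+O(\tau^2), \qquad (\ast)$$ where the remainder is $O(\tau^2)=\tau^2R(\phi,y,c,\tau)$, and its Melnikov function along $\Gamma$ (traversed in the direction of the flow) $$M(c,g)=-\frac1c\int_{\Gamma}\Big(\frac{2c-1}{c}\,y^2-\frac1c\,\phi y^2\Big)\,d\xi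 .$$ (1) For all real $g$ and all $c>0$ with $(c-1)^2>-2g$ the integral converges absolutely and $$M(c,g)=\frac{8}{35c^2}\sqrt{\frac1c}\,\big(15\sqrt{\Delta}+21c-21\big)\Delta^{5/4}-\frac{24(2c-1)}{5c^2}\sqrt{\frac1c}\,\Delta^{5/4}.$$ (2) For every $g>-\frac12$ there is exactly one $c=c(g)>0$ with $(c-1)^2>-2g$ and $M(c,g)=0$, and this zero is simple: $\frac{\partial M}{\partial c}(c(g),g)\neq0$. (3) Let $g>-\frac12$, let $\Gamma=\Gamma_{c(g),g}$, and let $R$ be any function of class $C^1$ on an open set $U\subset\mathbb R^4$ of points $(\phi,y,c,\tau)$ that contains $\overline\Gamma\times\{c(g)\}\times\{0\}$. Then there is a function $c(g,\tau)=c(g)+O(\tau)$ as $\tau\to0^+$ such that for all sufficiently small $\tau>0$ the system $(\ast)$ with $c=c(g,\tau)$ possesses a homoclinic orbit $\Gamma_\tau$ (a nonconstant solution on $\mathbb R$ that stays in the domain of the system and tends to one and the same equilibrium as $\xi\to\pm\infty$) near $\Gamma$, in the sense that the Hausdorff distance of $\Gamma_\tau$ and $\Gamma$ tends to $0$ as $\tau\to0^+$.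 -/

import Mathlib

open Filter Topology MeasureTheory

namespace RLW

noncomputable section

/-- `X` is a homoclinic orbit, lying in the domain `W`, of the autonomous planar system
`X' = V X`: a solution on the whole line, different from the equilibrium `p ∈ W`, that tends to
`p` in both time directions. -/
structure IsHomoclinicOrbit (V : ℝ × ℝ → ℝ × ℝ) (W : Set (ℝ × ℝ)) (p : ℝ × ℝ)
    (X : ℝ → ℝ × ℝ) : Prop where
  base_mem : p ∈ W
  equilibrium : V p = 0
  mem : ∀ ξ, X ξ ∈ W
  solves : ∀ ξ, HasDerivAt X (V (X ξ)) ξ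
  ne_base : ∀ ξ, X ξ ≠ p
  tendsto_atBot : Tendsto X atBot (𝓝 p)
  tendsto_atTop : Tendsto X atTop (𝓝 p)

/-- The vector field of the unperturbed travelling wave system
`φ' = y`, `y' = (1/c) [(c - 1) φ - φ² / 2 + g]`; points of the plane are `(φ, y)`. -/
def unperturbedField (c g : ℝ) (q : ℝ × ℝ) : ℝ × ℝ :=
  (q.2, 1 / c * ((c - 1) * q.1 - 1 / 2 * q.1 ^ 2 + g))

/-- The first integral `H(φ, y) = y² / 2 - (1/c) [(c - 1) φ² / 2 - φ³ / 6 + g φ]`. -/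
def firstIntegral (c g : ℝ) (q : ℝ × ℝ) : ℝ :=
  1 / 2 * q.2 ^ 2 - 1 / c * ((c - 1) / 2 * q.1 ^ 2 - 1 / 6 * q.1 ^ 3 + g * q.1)

/-- The coefficient of `τ` in the second component of the slow system with
Kuramoto-Sivashinsky perturbation: `-(1/c) ((2c - 1) / c * y - (1/c) φ y)`. -/
def perturbationKS (c : ℝ) (q : ℝ × ℝ) : ℝ :=
  -(1 / c * ((2 * c - 1) / c * q.2 - 1 / c * (q.1 * q.2)))

/-- The vector field of the slow system with Kuramoto-Sivashinsky perturbation,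
`φ' = y`,
`y' = (1/c) [(c - 1) φ - φ² / 2 + g] - τ (1/c) ((2c - 1) / c * y - (1/c) φ y) + O(τ²)`,
where the term `O(τ²)` is `τ² R(φ, y, c, τ)`. -/
def slowFieldKS (R : (ℝ × ℝ) × ℝ × ℝ → ℝ) (c g τ : ℝ) (q : ℝ × ℝ) : ℝ × ℝ :=
  (q.2, 1 / c * ((c - 1) * q.1 - 1 / 2 * q.1 ^ 2 + g) + τ * perturbationKS c q
    + τ ^ 2 * R (q, c, τ))

/-- `Δ = (c - 1)² + 2 g`. -/
def disc (c g : ℝ) : ℝ := (c - 1) ^ 2 + 2 * g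

/-- The first coordinate `φ₁ = c - 1 - √Δ` of the saddle. -/
def saddle (c g : ℝ) : ℝ := c - 1 - √(disc c g)

/-- The right intersection `φ_r = c - 1 + 2 √Δ` of the unperturbed loop with the `φ`-axis. -/
def rightPoint (c g : ℝ) : ℝ := c - 1 + 2 * √(disc c g)

/-- The `φ`-component of the unperturbed homoclinic solution,
`φ(ξ) = φ_r - (φ_r - φ₁) tanh² (½ √((φ_r - φ₁) / (3 c)) ξ)`. -/
def loopPhi (c g ξ : ℝ) : ℝ :=
  rightPoint c g - (rightPoint c g - saddle c g) *
    Real.tanh (1 / 2 * √((rightPoint c g - saddle c g) / (3 * c)) * ξ) ^ 2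

/-- The unperturbed homoclinic solution `(φ(ξ), φ'(ξ))`. -/
def loop (c g ξ : ℝ) : ℝ × ℝ := (loopPhi c g ξ, deriv (loopPhi c g) ξ)

/-- The unperturbed homoclinic loop `Γ`, as a set (without the saddle). -/
def Gam (c g : ℝ) : Set (ℝ × ℝ) := Set.range (loop c g)

/-- The integrand `y * (coefficient of τ)` of the Melnikov function along `Γ`, i.e.
`-(1/c) ((2c - 1) / c * y² - (1/c) φ y²)`. -/
def melnikovIntegrandKS (c g ξ : ℝ) : ℝ :=
  (loop c g ξ).2 * perturbationKS c (loop c g ξ)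

/-- The Melnikov function of the slow system. -/
def melnikovKS (c g : ℝ) : ℝ := ∫ ξ : ℝ, melnikovIntegrandKS c g ξ

/-! Helper facts: for `c > 0` and `Δ > 0` the set `Γ` really is a homoclinic loop of the
unperturbed system, on the energy level of the saddle. -/

theorem tanh_eq_one_sub (x : ℝ) : Real.tanh x = 1 - 2 / (Real.exp (2 * x) + 1) := by
  have h1 : Real.exp x > 0 := Real.exp_pos x
  have h2 : Real.exp (2 * x) = Real.exp x ^ 2 := by rw [← Real.exp_nat_mul]; norm_num
  rw [Real.tanh_eq_sinh_div_cosh, Real.sinh_eq, Real.cosh_eq, h2, Real.exp_neg]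
  field_simp
  ring

theorem hasDerivAt_tanh (x : ℝ) : HasDerivAt Real.tanh (1 - Real.tanh x ^ 2) x := by
  have hc : Real.cosh x ≠ 0 := (Real.cosh_pos x).ne'
  have h := (Real.hasDerivAt_sinh x).div (Real.hasDerivAt_cosh x) hc
  have e : Real.tanh = Real.sinh / Real.cosh := by
    funext y; exact Real.tanh_eq_sinh_div_cosh y
  rw [e]
  refine h.congr_deriv ?_
  simp only [Pi.div_apply]
  field_simp

theorem tendsto_tanh_atTop : Tendsto Real.tanh atTop (𝓝 1) := by
  have h : Tendsto (fun x : ℝ => Real.exp (2 * x) + 1) atTop atTop :=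
    tendsto_atTop_add_const_right _ _
      (Real.tendsto_exp_atTop.comp (tendsto_id.const_mul_atTop (by norm_num : (0 : ℝ) < 2)))
  have h2 : Tendsto (fun x : ℝ => 1 - 2 / (Real.exp (2 * x) + 1)) atTop (𝓝 (1 - 0)) :=
    tendsto_const_nhds.sub (h.const_div_atTop 2)
  rw [sub_zero] at h2
  exact h2.congr fun x => (tanh_eq_one_sub x).symm

theorem tanh_sq_lt_one (x : ℝ) : Real.tanh x ^ 2 < 1 := by
  have hc := Real.cosh_pos x
  have h := Real.cosh_sq x
  rw [Real.tanh_eq_sinh_div_cosh, div_pow, div_lt_one (by positivity)]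
  linarith

theorem rightPoint_sub_saddle (c g : ℝ) : rightPoint c g - saddle c g = 3 * √(disc c g) := by
  unfold rightPoint saddle; ring

theorem hasDerivAt_loopPhi (c g ξ : ℝ) :
    HasDerivAt (loopPhi c g)
      (-((3 * √(disc c g)) * √(3 * √(disc c g) / (3 * c)) *
        (Real.tanh (1 / 2 * √(3 * √(disc c g) / (3 * c)) * ξ) *
          (1 - Real.tanh (1 / 2 * √(3 * √(disc c g) / (3 * c)) * ξ) ^ 2)))) ξ := by
  have h0 : HasDerivAt (fun ξ : ℝ => 1 / 2 * √(3 * √(disc c g) / (3 * c)) * ξ)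
      (1 / 2 * √(3 * √(disc c g) / (3 * c))) ξ := by
    simpa using (hasDerivAt_id ξ).const_mul (1 / 2 * √(3 * √(disc c g) / (3 * c)))
  have h1 := (hasDerivAt_tanh _).comp ξ h0
  have h2 := ((h1.pow 2).const_mul (3 * √(disc c g))).const_sub (rightPoint c g)
  have e : loopPhi c g = fun ξ => rightPoint c g - (3 * √(disc c g)) *
      ((Real.tanh ∘ fun ξ : ℝ => 1 / 2 * √(3 * √(disc c g) / (3 * c)) * ξ) ^ 2) ξ := by
    funext ξ
    simp only [loopPhi, rightPoint_sub_saddle, Pi.pow_apply, Function.comp]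
  rw [e]
  refine h2.congr_deriv ?_
  simp only [Function.comp, Nat.cast_ofNat]
  ring

theorem loop_eq (c g ξ : ℝ) :
    loop c g ξ =
      (rightPoint c g - (3 * √(disc c g)) *
          Real.tanh (1 / 2 * √(3 * √(disc c g) / (3 * c)) * ξ) ^ 2,
        -((3 * √(disc c g)) * √(3 * √(disc c g) / (3 * c)) *
        (Real.tanh (1 / 2 * √(3 * √(disc c g) / (3 * c)) * ξ) *
          (1 - Real.tanh (1 / 2 * √(3 * √(disc c g) / (3 * c)) * ξ) ^ 2)))) := by
  unfold loop
  rw [(hasDerivAt_loopPhi c g ξ).deriv]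
  simp only [loopPhi, rightPoint_sub_saddle]

theorem loop_isHomoclinicOrbit {c g : ℝ} (hc : 0 < c) (hg : -2 * g < (c - 1) ^ 2) :
    IsHomoclinicOrbit (unperturbedField c g) Set.univ (saddle c g, 0) (loop c g) := by
  have hD : 0 < disc c g := by unfold disc; linarith
  obtain ⟨s, hs⟩ : ∃ s, s = √(disc c g) := ⟨_, rfl⟩
  have hs0 : 0 < s := hs ▸ Real.sqrt_pos.mpr hD
  have hss : s ^ 2 = (c - 1) ^ 2 + 2 * g := by rw [hs, Real.sq_sqrt hD.le]; rfl
  obtain ⟨k, hk⟩ : ∃ k, k = √(3 * √(disc c g) / (3 * c)) := ⟨_, rfl⟩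
  have hk0 : 0 < k := by rw [hk]; apply Real.sqrt_pos.mpr; rw [← hs]; positivity
  have hkk : k ^ 2 = s / c := by
    rw [hk, ← hs, Real.sq_sqrt (by positivity)]
    field_simp
  have hloop : ∀ ξ, loop c g ξ = (c - 1 + 2 * s - 3 * s * Real.tanh (1 / 2 * k * ξ) ^ 2,
      -(3 * s * k * (Real.tanh (1 / 2 * k * ξ) * (1 - Real.tanh (1 / 2 * k * ξ) ^ 2)))) := by
    intro ξ
    rw [loop_eq, ← hk, ← hs, rightPoint, ← hs]
  have hsad : saddle c g = c - 1 - s := by rw [saddle, hs]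
  have hlim : ∀ l : Filter ℝ, ∀ t : ℝ, t ^ 2 = 1 →
      Tendsto (fun ξ : ℝ => Real.tanh (1 / 2 * k * ξ)) l (𝓝 t) →
      Tendsto (loop c g) l (𝓝 (saddle c g, 0)) := by
    intro l t ht h
    have h2 := h.pow 2
    rw [ht] at h2
    have ha := (h2.const_mul (3 * s)).const_sub (c - 1 + 2 * s)
    have hb := ((h.mul (h2.const_sub 1)).const_mul (3 * s * k)).neg
    have hab := ha.prodMk_nhds hb
    rw [show (c - 1 + 2 * s - 3 * s * 1, -(3 * s * k * (t * (1 - 1)))) = (saddle c g, (0 : ℝ)) by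
      rw [hsad]; ext <;> simp; ring] at hab
    exact hab.congr fun ξ => (hloop ξ).symm
  have htop : Tendsto (fun ξ : ℝ => Real.tanh (1 / 2 * k * ξ)) atTop (𝓝 1) :=
    tendsto_tanh_atTop.comp (tendsto_id.const_mul_atTop (by positivity))
  refine ⟨trivial, ?_, fun _ => trivial, ?_, ?_, ?_, ?_⟩
  · rw [unperturbedField, hsad]
    ext
    · rfl
    · simp only [Prod.snd_zero]
      field_simp
      nlinarith
  · intro ξ
    have h0 : HasDerivAt (fun ξ : ℝ => 1 / 2 * k * ξ) (1 / 2 * k) ξ := by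
      simpa using (hasDerivAt_id ξ).const_mul (1 / 2 * k)
    have h1 := (hasDerivAt_tanh _).comp ξ h0
    have h2 := h1.pow 2
    have ha := (h2.const_mul (3 * s)).const_sub (c - 1 + 2 * s)
    have hb := ((h1.mul (h2.const_sub 1)).const_mul (3 * s * k)).neg
    have hab := ha.prodMk hb
    have e : loop c g = fun ξ => (c - 1 + 2 * s - 3 * s * Real.tanh (1 / 2 * k * ξ) ^ 2,
      -(3 * s * k * (Real.tanh (1 / 2 * k * ξ) * (1 - Real.tanh (1 / 2 * k * ξ) ^ 2)))) :=
      funext hloop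
    rw [e]
    refine HasDerivAt.congr_deriv hab ?_
    simp only [unperturbedField, Function.comp, Pi.pow_apply]
    generalize Real.tanh (1 / 2 * k * ξ) = T
    ext
    · simp only [Nat.cast_ofNat]; ring
    · have hg' : g = (s ^ 2 - (c - 1) ^ 2) / 2 := by linarith
      have : ∀ A : ℝ, A = 1 / c * ((c - 1) * (c - 1 + 2 * s - 3 * s * T ^ 2)
          - 1 / 2 * (c - 1 + 2 * s - 3 * s * T ^ 2) ^ 2 + g) ↔
          A = -(3 / 2) * s * (s / c) * ((1 - T ^ 2) * (1 - 3 * T ^ 2)) := by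
        intro A
        rw [hg']
        constructor <;> rintro rfl <;> field_simp <;> ring
      rw [this, ← hkk]
      simp only [Nat.cast_ofNat]
      ring
  · intro ξ h
    have h1 := congrArg Prod.fst h
    rw [hloop, hsad] at h1
    have := tanh_sq_lt_one (1 / 2 * k * ξ)
    simp only at h1
    nlinarith
  · refine hlim _ (-1) (by norm_num) ?_
    have := (htop.comp tendsto_neg_atBot_atTop).neg
    refine this.congr fun ξ => ?_
    simp [Function.comp, Real.tanh_neg]
  · exact hlim _ 1 (by norm_num) htop

theorem firstIntegral_loop {c g : ℝ} (hc : 0 < c) (hg : -2 * g < (c - 1) ^ 2) (ξ : ℝ) :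
    firstIntegral c g (loop c g ξ) = firstIntegral c g (saddle c g, 0) := by
  have hD : 0 < disc c g := by unfold disc; linarith
  obtain ⟨s, hs⟩ : ∃ s, s = √(disc c g) := ⟨_, rfl⟩
  have hs0 : 0 < s := hs ▸ Real.sqrt_pos.mpr hD
  have hss : s ^ 2 = (c - 1) ^ 2 + 2 * g := by rw [hs, Real.sq_sqrt hD.le]; rfl
  obtain ⟨k, hk⟩ : ∃ k, k = √(3 * √(disc c g) / (3 * c)) := ⟨_, rfl⟩
  have hkk : k ^ 2 = s / c := by
    rw [hk, ← hs, Real.sq_sqrt (by positivity)]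
    field_simp
  rw [loop_eq, ← hk, ← hs, rightPoint, saddle, ← hs]
  generalize Real.tanh (1 / 2 * k * ξ) = T
  have hg' : g = (s ^ 2 - (c - 1) ^ 2) / 2 := by linarith
  simp only [firstIntegral, neg_sq, mul_pow]
  rw [hkk, hg']
  field_simp
  ring

end

end RLW

/-!
The affine change of variables `φ = c - 1 + √Δ w`, `x = κ ξ`, `κ = ½ √(√Δ / c)` turns the slow system
into `w'' = 2 (1 - w²) + τ G (w, w', c, τ)` with a `C¹` function `G`, and the loop of every `c` into
the single solution `w₀ = 2 - 3 tanh²`.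

The Melnikov integral becomes, by the substitution `T = tanh x`, the integral of a polynomial over
`[-1, 1]`. It is a positive factor times `15 √Δ - 21 c` (`melnikovKS_eq`), so it vanishes exactly
where `25 Δ = 49 c²`. This quadratic equation in `c` has one positive root `melnikovZero g` when
`g > -1/2`, and there `15 √Δ - 21 c` has negative derivative (`hasDerivAt_melnikovKS`).

The homoclinic orbits come from a Lyapunov-Schmidt reduction on bounded continuous functions. The
difference `u = w - w₀` solves `u'' = q u + h` with `q = 12 tanh² - 8` and
`h = -2 u² + τ G (w, w', c, τ)`. The homogeneous equation has the decaying odd solution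
`y = tanh (1 - tanh²)`, a multiple of `w₀'`, and an explicit even solution growing like `cosh²`, so
variation of constants gives an operator, bounded in the supremum norm, that solves the equation
with `u'(0) = 0` whenever `∫ y h = 0` (`abs_res_le`). With `h` replaced by its projection
`h - λ y`, `λ = (15/4) ∫ y h`, the equation for `(u, u')` has a contracting right-hand side, after a
truncation that makes it globally defined, and its fixed point is of size `O(τ)` and Lipschitz in
`c`. Since the fixed point enters `h` only to order `τ²`, the bifurcation function is
`λ(c, τ) = (15/4) τ m(c) + O(τ²)`, where `m` is a nonvanishing multiple of the Melnikov function. At a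
simple zero of `m` the intermediate value theorem gives a zero `c = c₀ + O(τ)` of `λ(·, τ)`, for which
`w₀ + u` solves the equation itself (`exists_homoclinic_normalized`).

The solution has limits at both ends because the operator preserves the closed set of functions with
limits. The two limits agree since both are equilibria near the saddle, where the equilibrium is
unique (`IsRightHandSide.exists_tendsto_of_fixed`).
-/

namespace RLW

open scoped BoundedContinuousFunction NNReal

/-! ### The two solutions of the linearized equation -/

/-- The solution `y = tanh (1 - tanh²)` of `u'' = q u`, decaying at both ends; it is `-1/6` times
the derivative of the homoclinic solution `2 - 3 tanh²`. -/
noncomputable def decSol (x : ℝ) : ℝ := Real.tanh x * (1 - Real.tanh x ^ 2)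

/-- The derivative of `decSol`. -/
noncomputable def decSolDeriv (x : ℝ) : ℝ := (1 - Real.tanh x ^ 2) * (1 - 3 * Real.tanh x ^ 2)

/-- The potential `q = -4 w = 12 tanh² - 8` of the linearization `u'' = q u` of
`w'' = 2 (1 - w²)` along the homoclinic solution `w = 2 - 3 tanh²`. -/
noncomputable def potential (x : ℝ) : ℝ := 12 * Real.tanh x ^ 2 - 8

/-- The even solution of `u'' = q u` with Wronskian `1` against `decSol`; it grows like `cosh²`. -/
noncomputable def growSol (x : ℝ) : ℝ :=
  -(1 / 4) * Real.cosh x ^ 2 - 5 / 8 + 15 / 8 * (1 - Real.tanh x ^ 2) - 15 / 8 * (x * decSol x)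

/-- The derivative of `growSol`. -/
noncomputable def growSolDeriv (x : ℝ) : ℝ :=
  -(1 / 2) * (Real.cosh x * Real.sinh x) - 15 / 4 * decSol x
    - 15 / 8 * (decSol x + x * decSolDeriv x)

theorem cosh_sq_mul_one_sub_tanh_sq (x : ℝ) : Real.cosh x ^ 2 * (1 - Real.tanh x ^ 2) = 1 := by
  have hc : Real.cosh x ≠ 0 := (Real.cosh_pos x).ne'
  have h := Real.cosh_sq x
  rw [Real.tanh_eq_sinh_div_cosh]
  field_simp
  linarith

theorem cosh_mul_sinh (x : ℝ) : Real.cosh x * Real.sinh x = Real.cosh x ^ 2 * Real.tanh x := by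
  have hc : Real.cosh x ≠ 0 := (Real.cosh_pos x).ne'
  rw [Real.tanh_eq_sinh_div_cosh]
  field_simp

theorem hasDerivAt_decSol (x : ℝ) : HasDerivAt decSol (decSolDeriv x) x := by
  have h := hasDerivAt_tanh x
  refine (h.mul ((h.pow 2).const_sub 1)).congr_deriv ?_
  simp only [decSolDeriv, Pi.pow_apply]; push_cast; ring

theorem hasDerivAt_decSolDeriv (x : ℝ) :
    HasDerivAt decSolDeriv (potential x * decSol x) x := by
  have h := hasDerivAt_tanh x
  refine (((h.pow 2).const_sub 1).mul (((h.pow 2).const_mul 3).const_sub 1)).congr_deriv ?_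
  simp only [potential, decSol, Pi.pow_apply]; push_cast; ring

theorem hasDerivAt_growSol (x : ℝ) : HasDerivAt growSol (growSolDeriv x) x := by
  have h := hasDerivAt_tanh x
  have h1 := ((Real.hasDerivAt_cosh x).pow 2).const_mul (-(1 / 4))
  have h2 := ((h.pow 2).const_sub 1).const_mul (15 / 8)
  have h3 := ((hasDerivAt_id x).mul (hasDerivAt_decSol x)).const_mul (15 / 8)
  refine (((h1.sub_const (5 / 8)).add h2).sub h3).congr_deriv ?_
  simp only [growSolDeriv, decSol, id]; push_cast; ring

theorem hasDerivAt_growSolDeriv (x : ℝ) :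
    HasDerivAt growSolDeriv (potential x * growSol x) x := by
  have h1 := ((Real.hasDerivAt_cosh x).mul (Real.hasDerivAt_sinh x)).const_mul (-(1 / 2))
  have h2 := (hasDerivAt_decSol x).const_mul (15 / 4)
  have h3 := ((hasDerivAt_decSol x).add
    ((hasDerivAt_id x).mul (hasDerivAt_decSolDeriv x))).const_mul (15 / 8)
  refine ((h1.sub h2).sub h3).congr_deriv ?_
  have hP := cosh_sq_mul_one_sub_tanh_sq x
  have hs : Real.sinh x * Real.sinh x = Real.cosh x ^ 2 - 1 := by
    have := Real.cosh_sq x; linarith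
  have hs' : Real.sinh x * Real.sinh x + Real.cosh x * Real.cosh x = 2 * Real.cosh x ^ 2 - 1 := by
    rw [hs]; ring
  simp only [growSol, potential, decSol, decSolDeriv, id]
  rw [hs']
  generalize Real.cosh x ^ 2 = P at *
  generalize Real.tanh x = T at *
  linear_combination (-3) * hP

theorem wronskian (x : ℝ) :
    decSolDeriv x * growSol x - decSol x * growSolDeriv x = 1 := by
  have hP := cosh_sq_mul_one_sub_tanh_sq x
  simp only [growSol, growSolDeriv, cosh_mul_sinh, decSol, decSolDeriv]
  generalize Real.cosh x ^ 2 = P at *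
  generalize Real.tanh x = T at *
  linear_combination (-(1 / 4) * (1 - 3 * T ^ 2) + 1 / 2 * T ^ 2) * hP

theorem decSolDeriv_zero : decSolDeriv 0 = 1 := by simp [decSolDeriv]
theorem growSolDeriv_zero : growSolDeriv 0 = 0 := by simp [growSolDeriv, decSol]

theorem decSol_neg (x : ℝ) : decSol (-x) = -decSol x := by
  simp only [decSol, Real.tanh_neg]; ring
theorem decSolDeriv_neg (x : ℝ) : decSolDeriv (-x) = decSolDeriv x := by
  simp only [decSolDeriv, Real.tanh_neg]; ring
theorem growSol_neg (x : ℝ) : growSol (-x) = growSol x := by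
  simp only [growSol, decSol_neg, Real.tanh_neg, Real.cosh_neg]; ring
theorem growSolDeriv_neg (x : ℝ) : growSolDeriv (-x) = -growSolDeriv x := by
  simp only [growSolDeriv, decSol_neg, decSolDeriv_neg, Real.cosh_neg, Real.sinh_neg]; ring

theorem continuous_tanh : Continuous Real.tanh :=
  continuous_iff_continuousAt.2 fun x => (hasDerivAt_tanh x).continuousAt
theorem continuous_decSol : Continuous decSol :=
  continuous_iff_continuousAt.2 fun x => (hasDerivAt_decSol x).continuousAt
theorem continuous_growSol : Continuous growSol :=
  continuous_iff_continuousAt.2 fun x => (hasDerivAt_growSol x).continuousAt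
theorem continuous_potential : Continuous potential :=
  ((continuous_tanh.pow 2).const_mul 12).sub continuous_const

theorem abs_tanh_le_one (x : ℝ) : |Real.tanh x| ≤ 1 :=
  (sq_le_one_iff_abs_le_one _).1 (tanh_sq_lt_one x).le

theorem one_sub_tanh_sq_pos (x : ℝ) : 0 < 1 - Real.tanh x ^ 2 := by
  linarith [tanh_sq_lt_one x]

theorem one_sub_tanh_sq_le_one (x : ℝ) : 1 - Real.tanh x ^ 2 ≤ 1 := by
  linarith [sq_nonneg (Real.tanh x)]

theorem one_le_cosh_sq (x : ℝ) : 1 ≤ Real.cosh x ^ 2 := by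
  have := Real.one_le_cosh x
  nlinarith

theorem abs_le_cosh_sq (x : ℝ) : |x| ≤ Real.cosh x ^ 2 := by
  have h1 : |x| ≤ Real.cosh x := by
    rw [← Real.cosh_abs]
    exact (Real.self_le_sinh_iff.2 (abs_nonneg x)).trans (Real.sinh_lt_cosh _).le
  have := Real.one_le_cosh x
  nlinarith

theorem abs_decSol_le (x : ℝ) : |decSol x| ≤ 1 - Real.tanh x ^ 2 := by
  rw [decSol, abs_mul, abs_of_pos (one_sub_tanh_sq_pos x)]
  exact mul_le_of_le_one_left (one_sub_tanh_sq_pos x).le (abs_tanh_le_one x)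

theorem abs_decSolDeriv_le (x : ℝ) : |decSolDeriv x| ≤ 2 * (1 - Real.tanh x ^ 2) := by
  rw [decSolDeriv, abs_mul, abs_of_pos (one_sub_tanh_sq_pos x), mul_comm]
  refine mul_le_mul_of_nonneg_right ?_ (one_sub_tanh_sq_pos x).le
  rw [abs_le]
  constructor <;> nlinarith [tanh_sq_lt_one x, sq_nonneg (Real.tanh x)]

theorem abs_growSol_le (x : ℝ) : |growSol x| ≤ 5 * Real.cosh x ^ 2 := by
  have h1 := one_le_cosh_sq x
  have h2 : |x * decSol x| ≤ 1 := by
    rw [abs_mul]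
    calc |x| * |decSol x| ≤ Real.cosh x ^ 2 * (1 - Real.tanh x ^ 2) :=
          mul_le_mul (abs_le_cosh_sq x) (abs_decSol_le x) (abs_nonneg _) (by positivity)
      _ = 1 := cosh_sq_mul_one_sub_tanh_sq x
  have h3 := one_sub_tanh_sq_pos x
  have h4 := one_sub_tanh_sq_le_one x
  rw [abs_le] at h2 ⊢
  unfold growSol
  constructor <;> linarith [h2.1, h2.2]

theorem abs_growSolDeriv_le (x : ℝ) : |growSolDeriv x| ≤ 10 * Real.cosh x ^ 2 := by
  have h1 := one_le_cosh_sq x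
  have h2 : |x * decSolDeriv x| ≤ 2 := by
    rw [abs_mul]
    calc |x| * |decSolDeriv x| ≤ Real.cosh x ^ 2 * (2 * (1 - Real.tanh x ^ 2)) :=
          mul_le_mul (abs_le_cosh_sq x) (abs_decSolDeriv_le x) (abs_nonneg _) (by positivity)
      _ = 2 := by linarith [cosh_sq_mul_one_sub_tanh_sq x]
  have h3 := (abs_decSol_le x).trans (one_sub_tanh_sq_le_one x)
  have h5 : |Real.cosh x ^ 2 * Real.tanh x| ≤ Real.cosh x ^ 2 := by
    rw [abs_mul, abs_of_nonneg (by positivity : 0 ≤ Real.cosh x ^ 2)]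
    exact mul_le_of_le_one_right (by positivity) (abs_tanh_le_one x)
  rw [abs_le] at h2 h3 h5 ⊢
  unfold growSolDeriv
  rw [cosh_mul_sinh]
  constructor <;> linarith [h2.1, h2.2, h3.1, h3.2, h5.1, h5.2]

theorem abs_potential_le (x : ℝ) : |potential x| ≤ 8 := by
  rw [abs_le]; unfold potential
  constructor <;> linarith [tanh_sq_lt_one x, sq_nonneg (Real.tanh x)]

theorem tendsto_tanh_atBot : Tendsto Real.tanh atBot (𝓝 (-1)) := by
  refine (tendsto_tanh_atTop.comp tendsto_neg_atBot_atTop).neg.congr fun x => ?_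
  simp [Function.comp, Real.tanh_neg]

theorem tendsto_one_sub_tanh_sq : Tendsto (fun x => 1 - Real.tanh x ^ 2) atTop (𝓝 0) := by
  simpa using (tendsto_tanh_atTop.pow 2).const_sub 1

theorem integrable_one_sub_tanh_sq : Integrable fun x : ℝ => 1 - Real.tanh x ^ 2 := by
  have h1 : IntegrableOn (fun x : ℝ => 1 - Real.tanh x ^ 2) (Set.Ioi 0) :=
    integrableOn_Ioi_deriv_of_nonneg' (fun x _ => hasDerivAt_tanh x)
      (fun x _ => (one_sub_tanh_sq_pos x).le) tendsto_tanh_atTop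
  have h2 : IntegrableOn (fun x : ℝ => 1 - Real.tanh x ^ 2) (Set.Iic 0) := by
    have h : IntegrableOn (fun x : ℝ => 1 - Real.tanh x ^ 2) (Set.Ici 0) := by
      rwa [integrableOn_Ici_iff_integrableOn_Ioi]
    have h' := h.comp_neg
    simpa [Real.tanh_neg] using h'
  simpa [Set.Iic_union_Ioi] using h2.union h1

theorem integrable_mul_of_abs_le {f k : ℝ → ℝ} (hf : Continuous f) (hk : Continuous k) {C B : ℝ}
    (hfC : ∀ x, |f x| ≤ C * (1 - Real.tanh x ^ 2)) (hkB : ∀ x, |k x| ≤ B) :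
    Integrable fun x => f x * k x := by
  refine (integrable_one_sub_tanh_sq.const_mul (C * B)).mono'
    (hf.mul hk).aestronglyMeasurable (ae_of_all _ fun x => ?_)
  rw [Real.norm_eq_abs, abs_mul]
  calc |f x| * |k x| ≤ C * (1 - Real.tanh x ^ 2) * B :=
        mul_le_mul (hfC x) (hkB x) (abs_nonneg _) ((abs_nonneg _).trans (hfC x))
    _ = _ := by ring

theorem integrable_decSol_mul {k : ℝ → ℝ} (hk : Continuous k) {B : ℝ} (hkB : ∀ x, |k x| ≤ B) :
    Integrable fun x => decSol x * k x :=
  integrable_mul_of_abs_le continuous_decSol hk (C := 1)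
    (fun x => by simpa using abs_decSol_le x) hkB

theorem integral_Ioi_decSol (x : ℝ) :
    ∫ t in Set.Ioi x, decSol t = (1 - Real.tanh x ^ 2) / 2 := by
  have h : ∀ t ∈ Set.Ici x, HasDerivAt (fun t => Real.tanh t ^ 2 / 2) (decSol t) t := fun t _ => by
    refine (((hasDerivAt_tanh t).pow 2).div_const 2).congr_deriv ?_
    simp only [decSol]; push_cast; ring
  rw [integral_Ioi_of_hasDerivAt_of_tendsto' h
    (by simpa using (integrable_decSol_mul continuous_const (k := fun _ => 1) (B := 1)
      (by simp)).integrableOn) ((tendsto_tanh_atTop.pow 2).div_const 2)]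
  ring

theorem decSol_nonneg {x : ℝ} (hx : 0 ≤ x) : 0 ≤ decSol x := by
  refine mul_nonneg ?_ (one_sub_tanh_sq_pos x).le
  rw [Real.tanh_eq_sinh_div_cosh]
  exact div_nonneg (Real.sinh_nonneg_iff.2 hx) (Real.cosh_pos x).le

theorem integral_abs_decSol : ∫ t, |decSol t| = 1 := by
  have h : ∀ t, |decSol t| = decSol |t| := fun t => by
    rcases le_total 0 t with ht | ht
    · rw [abs_of_nonneg ht, abs_of_nonneg (decSol_nonneg ht)]
    · rw [abs_of_nonpos ht, ← abs_neg, ← decSol_neg,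
        abs_of_nonneg (decSol_nonneg (neg_nonneg.2 ht))]
  simp_rw [h]
  rw [integral_comp_abs (f := decSol), integral_Ioi_decSol]
  simp

/-- The substitution `T = tanh x` in an integral over the line. -/
theorem integral_comp_tanh_mul {p P : ℝ → ℝ} (hP : ∀ t, HasDerivAt P (p t) t)
    (hp : Continuous p) :
    Integrable (fun x => p (Real.tanh x) * (1 - Real.tanh x ^ 2)) ∧
      ∫ x, p (Real.tanh x) * (1 - Real.tanh x ^ 2) = P 1 - P (-1) := by
  obtain ⟨B, hB⟩ := (isCompact_Icc (a := (-1 : ℝ)) (b := 1)).exists_bound_of_continuousOn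
    hp.continuousOn
  have hi : Integrable (fun x => p (Real.tanh x) * (1 - Real.tanh x ^ 2)) := by
    have := integrable_mul_of_abs_le (f := fun x => 1 - Real.tanh x ^ 2)
      (continuous_const.sub (continuous_tanh.pow 2)) (hp.comp continuous_tanh) (C := 1) (B := B)
      (fun x => by rw [one_mul, abs_of_pos (one_sub_tanh_sq_pos x)])
      (fun x => hB _ (abs_le.1 (abs_tanh_le_one x)))
    exact this.congr (ae_of_all _ fun x => mul_comm _ _)
  have hc : ∀ t, ContinuousAt P t := fun t => (hP t).continuousAt
  exact ⟨hi, integral_of_hasDerivAt_of_tendsto (fun x => (hP _).comp x (hasDerivAt_tanh x)) hi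
    ((hc _).tendsto.comp tendsto_tanh_atBot) ((hc _).tendsto.comp tendsto_tanh_atTop)⟩

theorem integral_decSol_mul_decSol : ∫ x, decSol x * decSol x = 4 / 15 := by
  have hP : ∀ t : ℝ, HasDerivAt (fun t : ℝ => t ^ 3 / 3 - t ^ 5 / 5) (t ^ 2 - t ^ 4) t := fun t => by
    refine (((hasDerivAt_pow 3 t).div_const 3).sub ((hasDerivAt_pow 5 t).div_const 5)).congr_deriv ?_
    push_cast; ring
  have h := (integral_comp_tanh_mul hP (by fun_prop)).2
  have e : (fun x => decSol x * decSol x) =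
      fun x => (Real.tanh x ^ 2 - Real.tanh x ^ 4) * (1 - Real.tanh x ^ 2) := by
    funext x; simp only [decSol]; ring
  rw [e, h]; norm_num

/-! ### Bounded solutions of the inhomogeneous linearized equation -/

/-- The pairing of `h` with `decSol` over the right half-line. -/
noncomputable def halfPairing (h : ℝ → ℝ) : ℝ := ∫ t in Set.Ioi 0, decSol t * h t

/-- The solution of `u'' = q u + h` given by variation of constants that has `u'(0) = 0` and, for
bounded `h`, stays bounded on the right half-line. -/
noncomputable def resU (h : ℝ → ℝ) (x : ℝ) : ℝ :=
  growSol x * (halfPairing h - ∫ t in (0 : ℝ)..x, decSol t * h t)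
    + decSol x * ∫ t in (0 : ℝ)..x, growSol t * h t

/-- The derivative of `resU h`. -/
noncomputable def resV (h : ℝ → ℝ) (x : ℝ) : ℝ :=
  growSolDeriv x * (halfPairing h - ∫ t in (0 : ℝ)..x, decSol t * h t)
    + decSolDeriv x * ∫ t in (0 : ℝ)..x, growSol t * h t

theorem hasDerivAt_resU {h : ℝ → ℝ} (hh : Continuous h) (x : ℝ) :
    HasDerivAt (resU h) (resV h x) x := by
  have h1 : HasDerivAt (fun s => ∫ t in (0 : ℝ)..s, decSol t * h t) (decSol x * h x) x :=
    ((continuous_decSol.mul hh).integral_hasStrictDerivAt 0 x).hasDerivAt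
  have h2 : HasDerivAt (fun s => ∫ t in (0 : ℝ)..s, growSol t * h t) (growSol x * h x) x :=
    ((continuous_growSol.mul hh).integral_hasStrictDerivAt 0 x).hasDerivAt
  refine (((hasDerivAt_growSol x).mul (h1.const_sub (halfPairing h))).add
    ((hasDerivAt_decSol x).mul h2)).congr_deriv ?_
  simp only [resV]; ring

theorem hasDerivAt_resV {h : ℝ → ℝ} (hh : Continuous h) (x : ℝ) :
    HasDerivAt (resV h) (potential x * resU h x + h x) x := by
  have h1 : HasDerivAt (fun s => ∫ t in (0 : ℝ)..s, decSol t * h t) (decSol x * h x) x :=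
    ((continuous_decSol.mul hh).integral_hasStrictDerivAt 0 x).hasDerivAt
  have h2 : HasDerivAt (fun s => ∫ t in (0 : ℝ)..s, growSol t * h t) (growSol x * h x) x :=
    ((continuous_growSol.mul hh).integral_hasStrictDerivAt 0 x).hasDerivAt
  refine (((hasDerivAt_growSolDeriv x).mul (h1.const_sub (halfPairing h))).add
    ((hasDerivAt_decSolDeriv x).mul h2)).congr_deriv ?_
  simp only [resU]
  linear_combination (h x) * wronskian x

theorem abs_integral_Ioi_decSol_mul_le {h : ℝ → ℝ} {B x : ℝ} (hx : 0 ≤ x)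
    (hB : ∀ t, x < t → |h t| ≤ B) :
    |∫ t in Set.Ioi x, decSol t * h t| ≤ (1 - Real.tanh x ^ 2) / 2 * B := by
  have hi : IntegrableOn decSol (Set.Ioi x) := by
    simpa using (integrable_decSol_mul continuous_const (k := fun _ => 1) (B := 1)
      (by simp)).integrableOn
  rw [← integral_Ioi_decSol, ← integral_mul_const, ← Real.norm_eq_abs]
  refine norm_integral_le_of_norm_le (hi.mul_const B) ?_
  refine (ae_restrict_mem measurableSet_Ioi).mono fun t ht => ?_
  have h0 := decSol_nonneg (hx.trans (le_of_lt ht))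
  rw [norm_mul, Real.norm_of_nonneg h0]
  exact mul_le_mul_of_nonneg_left (hB t ht) h0

theorem abs_integral_growSol_mul_le {h : ℝ → ℝ} {B a x : ℝ} (ha : 0 ≤ a) (hax : a ≤ x)
    (hB : ∀ t, a ≤ t → |h t| ≤ B) :
    |∫ t in a..x, growSol t * h t| ≤ 5 * B * Real.cosh x ^ 2 := by
  have hB0 : 0 ≤ B := (abs_nonneg _).trans (hB a le_rfl)
  have hd : ∀ t : ℝ, HasDerivAt (fun t => 5 * B * (Real.sinh t * Real.cosh t))
      (5 * B * (Real.cosh t * Real.cosh t + Real.sinh t * Real.sinh t)) t := fun t =>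
    ((Real.hasDerivAt_sinh t).mul (Real.hasDerivAt_cosh t)).const_mul _
  have hc : Continuous fun t : ℝ =>
      5 * B * (Real.cosh t * Real.cosh t + Real.sinh t * Real.sinh t) := by fun_prop
  have hF := intervalIntegral.integral_eq_sub_of_hasDerivAt (fun t _ => hd t)
    (hc.intervalIntegrable a x)
  have h1 : |∫ t in a..x, growSol t * h t| ≤
      ∫ t in a..x, 5 * B * (Real.cosh t * Real.cosh t + Real.sinh t * Real.sinh t) := by
    rw [← Real.norm_eq_abs]
    refine intervalIntegral.norm_integral_le_of_norm_le hax ?_ (hc.intervalIntegrable a x)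
    refine ae_of_all _ fun t ht => ?_
    rw [norm_mul, Real.norm_eq_abs, Real.norm_eq_abs]
    calc |growSol t| * |h t| ≤ 5 * Real.cosh t ^ 2 * B :=
          mul_le_mul (abs_growSol_le t) (hB t ht.1.le) (abs_nonneg _) (by positivity)
      _ ≤ _ := by nlinarith [mul_nonneg hB0 (mul_self_nonneg (Real.sinh t))]
  rw [hF] at h1
  have h2 : 0 ≤ Real.sinh a * Real.cosh a :=
    mul_nonneg (Real.sinh_nonneg_iff.2 ha) (Real.cosh_pos a).le
  have h3 : Real.sinh x * Real.cosh x ≤ Real.cosh x ^ 2 := by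
    rw [pow_two]
    exact mul_le_mul_of_nonneg_right (Real.sinh_lt_cosh x).le (Real.cosh_pos x).le
  refine h1.trans ?_
  rw [← mul_sub]
  exact mul_le_mul_of_nonneg_left (by linarith) (by positivity)

/-- Estimate of the solution operator on the right half-line: only the size of `h` beyond `a`
enters, up to a term that decays. -/
theorem abs_res_le_of_le {h : ℝ → ℝ} (hh : Continuous h) {B₀ : ℝ} (hB₀ : ∀ t, |h t| ≤ B₀)
    {a B x : ℝ} (ha : 0 ≤ a) (hB : ∀ t, a ≤ t → |h t| ≤ B) (hx : a ≤ x) :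
    |resU h x| ≤ 15 / 2 * B
        + (1 - Real.tanh x ^ 2) * |∫ t in (0 : ℝ)..a, growSol t * h t| ∧
      |resV h x| ≤ 15 * B
        + 2 * (1 - Real.tanh x ^ 2) * |∫ t in (0 : ℝ)..a, growSol t * h t| := by
  have hB0 : 0 ≤ B := (abs_nonneg _).trans (hB a le_rfl)
  have hI : halfPairing h - ∫ t in (0 : ℝ)..x, decSol t * h t
      = ∫ t in Set.Ioi x, decSol t * h t := by
    have hi := integrable_decSol_mul hh hB₀
    rw [halfPairing, ← intervalIntegral.integral_interval_add_Ioi hi.integrableOn hi.integrableOn]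
    ring
  have h1 := abs_integral_Ioi_decSol_mul_le (ha.trans hx) fun t ht => hB t (hx.trans ht.le)
  have hJ : ∫ t in (0 : ℝ)..x, growSol t * h t =
      (∫ t in (0 : ℝ)..a, growSol t * h t) + ∫ t in a..x, growSol t * h t :=
    (intervalIntegral.integral_add_adjacent_intervals
      ((continuous_growSol.mul hh).intervalIntegrable _ _)
      ((continuous_growSol.mul hh).intervalIntegrable _ _)).symm
  have h2 : |∫ t in (0 : ℝ)..x, growSol t * h t| ≤
      |∫ t in (0 : ℝ)..a, growSol t * h t| + 5 * B * Real.cosh x ^ 2 := by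
    rw [hJ]
    exact (abs_add_le _ _).trans (add_le_add_right (abs_integral_growSol_mul_le ha hx hB) _)
  have hP := cosh_sq_mul_one_sub_tanh_sq x
  have hs := one_sub_tanh_sq_pos x
  simp only [resU, resV]
  rw [hI]
  constructor
  · refine (abs_add_le _ _).trans ?_
    rw [abs_mul, abs_mul]
    have e1 := mul_le_mul (abs_growSol_le x) h1 (abs_nonneg _) (by positivity)
    have e2 := mul_le_mul (abs_decSol_le x) h2 (abs_nonneg _) hs.le
    refine (add_le_add e1 e2).trans (le_of_eq ?_)
    linear_combination (15 / 2 * B) * hP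
  · refine (abs_add_le _ _).trans ?_
    rw [abs_mul, abs_mul]
    have e1 := mul_le_mul (abs_growSolDeriv_le x) h1 (abs_nonneg _) (by positivity)
    have e2 := mul_le_mul (abs_decSolDeriv_le x) h2 (abs_nonneg _) (by positivity)
    refine (add_le_add e1 e2).trans (le_of_eq ?_)
    linear_combination (15 * B) * hP

theorem abs_res_le_of_nonneg {h : ℝ → ℝ} (hh : Continuous h) {B : ℝ} (hB : ∀ t, |h t| ≤ B)
    {x : ℝ} (hx : 0 ≤ x) : |resU h x| ≤ 15 * B ∧ |resV h x| ≤ 15 * B := by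
  have hB0 : 0 ≤ B := (abs_nonneg _).trans (hB 0)
  have := abs_res_le_of_le hh hB le_rfl (fun t _ => hB t) hx
  simp only [intervalIntegral.integral_same, abs_zero, mul_zero, add_zero] at this
  exact ⟨this.1.trans (by linarith), this.2⟩

/-- If the two half-line pairings of `h` with the odd function `decSol` balance, then `resU`
commutes with the reflection `x ↦ -x`, so that all estimates carry over to the left half-line. -/
theorem res_neg {h : ℝ → ℝ} (hp : halfPairing (fun t => h (-t)) = halfPairing h) (x : ℝ) :
    resU h (-x) = resU (fun t => h (-t)) x ∧ resV h (-x) = -resV (fun t => h (-t)) x := by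
  have h1 : ∫ t in (0 : ℝ)..(-x), decSol t * h t = ∫ t in (0 : ℝ)..x, decSol t * h (-t) := by
    have := intervalIntegral.integral_comp_neg (fun t => decSol t * h t) (a := 0) (b := x)
    rw [neg_zero, intervalIntegral.integral_symm 0 (-x)] at this
    rw [← neg_inj, ← this, ← intervalIntegral.integral_neg]
    simp [decSol_neg]
  have h2 : ∫ t in (0 : ℝ)..(-x), growSol t * h t = -∫ t in (0 : ℝ)..x, growSol t * h (-t) := by
    have := intervalIntegral.integral_comp_neg (fun t => growSol t * h t) (a := 0) (b := x)
    rw [neg_zero, intervalIntegral.integral_symm 0 (-x)] at this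
    rw [← neg_inj, ← this]
    simp [growSol_neg]
  simp only [resU, resV, h1, h2, hp, growSol_neg, decSol_neg, growSolDeriv_neg, decSolDeriv_neg]
  constructor <;> ring

theorem abs_res_le {h : ℝ → ℝ} (hh : Continuous h) {B : ℝ} (hB : ∀ t, |h t| ≤ B)
    (hp : halfPairing (fun t => h (-t)) = halfPairing h) (x : ℝ) :
    |resU h x| ≤ 15 * B ∧ |resV h x| ≤ 15 * B := by
  rcases le_total 0 x with hx | hx
  · exact abs_res_le_of_nonneg hh hB hx
  · obtain ⟨e1, e2⟩ := res_neg hp (-x)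
    rw [neg_neg] at e1 e2
    rw [e1, e2, abs_neg]
    exact abs_res_le_of_nonneg (hh.comp continuous_neg) (fun t => hB _) (neg_nonneg.2 hx)

theorem halfPairing_sub {h k : ℝ → ℝ} (hh : Continuous h) (hk : Continuous k) {B C : ℝ}
    (hB : ∀ t, |h t| ≤ B) (hC : ∀ t, |k t| ≤ C) :
    halfPairing (fun t => h t - k t) = halfPairing h - halfPairing k := by
  simp only [halfPairing, mul_sub]
  exact integral_sub (integrable_decSol_mul hh hB).integrableOn
    (integrable_decSol_mul hk hC).integrableOn

theorem res_sub {h k : ℝ → ℝ} (hh : Continuous h) (hk : Continuous k) {B C : ℝ}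
    (hB : ∀ t, |h t| ≤ B) (hC : ∀ t, |k t| ≤ C) (x : ℝ) :
    resU (fun t => h t - k t) x = resU h x - resU k x ∧
      resV (fun t => h t - k t) x = resV h x - resV k x := by
  have h1 : ∫ t in (0 : ℝ)..x, decSol t * (h t - k t) =
      (∫ t in (0 : ℝ)..x, decSol t * h t) - ∫ t in (0 : ℝ)..x, decSol t * k t := by
    simp only [mul_sub]
    exact intervalIntegral.integral_sub ((continuous_decSol.mul hh).intervalIntegrable _ _)
      ((continuous_decSol.mul hk).intervalIntegrable _ _)
  have h2 : ∫ t in (0 : ℝ)..x, growSol t * (h t - k t) =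
      (∫ t in (0 : ℝ)..x, growSol t * h t) - ∫ t in (0 : ℝ)..x, growSol t * k t := by
    simp only [mul_sub]
    exact intervalIntegral.integral_sub ((continuous_growSol.mul hh).intervalIntegrable _ _)
      ((continuous_growSol.mul hk).intervalIntegrable _ _)
  simp only [resU, resV, halfPairing_sub hh hk hB hC, h1, h2]
  constructor <;> ring

/-- The constant `-l / 4` solves `u'' = q u + l q / 4`; this right-hand side tends to `l`, which
reduces the limits of the solution operator to the case of limit `0`. -/
theorem res_potential (l x : ℝ) :
    resU (fun t => l * (potential t / 4)) x = -(l / 4) ∧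
      resV (fun t => l * (potential t / 4)) x = 0 := by
  have hd : ∀ t : ℝ, HasDerivAt (fun t => l / 4 * decSolDeriv t)
      (decSol t * (l * (potential t / 4))) t := fun t =>
    ((hasDerivAt_decSolDeriv t).const_mul (l / 4)).congr_deriv (by ring)
  have hg : ∀ t : ℝ, HasDerivAt (fun t => l / 4 * growSolDeriv t)
      (growSol t * (l * (potential t / 4))) t := fun t =>
    ((hasDerivAt_growSolDeriv t).const_mul (l / 4)).congr_deriv (by ring)
  have hc : Continuous fun t => l * (potential t / 4) :=
    (continuous_potential.div_const 4).const_mul l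
  have h1 : ∫ t in (0 : ℝ)..x, decSol t * (l * (potential t / 4)) =
      l / 4 * decSolDeriv x - l / 4 := by
    rw [intervalIntegral.integral_eq_sub_of_hasDerivAt (fun t _ => hd t)
      ((continuous_decSol.mul hc).intervalIntegrable _ _), decSolDeriv_zero, mul_one]
  have h2 : ∫ t in (0 : ℝ)..x, growSol t * (l * (potential t / 4)) = l / 4 * growSolDeriv x := by
    rw [intervalIntegral.integral_eq_sub_of_hasDerivAt (fun t _ => hg t)
      ((continuous_growSol.mul hc).intervalIntegrable _ _), growSolDeriv_zero, mul_zero, sub_zero]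
  have h3 : halfPairing (fun t => l * (potential t / 4)) = -(l / 4) := by
    have ht : Tendsto (fun t => l / 4 * decSolDeriv t) atTop (𝓝 (l / 4 * 0)) := by
      refine Tendsto.const_mul _ (squeeze_zero_norm abs_decSolDeriv_le ?_)
      simpa using tendsto_one_sub_tanh_sq.const_mul 2
    have hb : ∀ t, |l * (potential t / 4)| ≤ |l| * 2 := fun t => by
      rw [abs_mul, abs_div, abs_of_pos (by norm_num : (0 : ℝ) < 4)]
      exact mul_le_mul_of_nonneg_left (by linarith [abs_potential_le t]) (abs_nonneg l)
    rw [halfPairing, integral_Ioi_of_hasDerivAt_of_tendsto' (fun t _ => hd t)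
      (integrable_decSol_mul hc hb).integrableOn ht, decSolDeriv_zero]
    ring
  have hw := wronskian x
  simp only [resU, resV, h1, h2, h3]
  constructor
  · linear_combination (-(l / 4)) * hw
  · ring

/-- The solution operator preserves decay at `+∞`. -/
theorem tendsto_res_atTop_zero {h : ℝ → ℝ} (hh : Continuous h) {B : ℝ} (hB : ∀ t, |h t| ≤ B)
    (hl : Tendsto h atTop (𝓝 0)) :
    Tendsto (resU h) atTop (𝓝 0) ∧ Tendsto (resV h) atTop (𝓝 0) := by
  have key : ∀ ε > 0, ∀ᶠ x in atTop, |resU h x| < ε ∧ |resV h x| < ε := by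
    intro ε hε
    obtain ⟨a₀, ha₀⟩ := eventually_atTop.1
      ((tendsto_order.1 hl.abs).2 (ε / 30) (by rw [abs_zero]; positivity))
    have hs := (tendsto_order.1 (tendsto_one_sub_tanh_sq.mul_const
      (2 * |∫ t in (0 : ℝ)..(max a₀ 0), growSol t * h t|))).2 (ε / 2)
      (by rw [zero_mul]; positivity)
    filter_upwards [hs, eventually_ge_atTop (max a₀ 0)] with x h1 hx
    obtain ⟨e1, e2⟩ := abs_res_le_of_le hh hB (le_max_right a₀ 0)
      (fun t ht => (ha₀ t ((le_max_left _ _).trans ht)).le) hx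
    have := mul_nonneg (one_sub_tanh_sq_pos x).le
      (abs_nonneg (∫ t in (0 : ℝ)..(max a₀ 0), growSol t * h t))
    constructor
    · linarith
    · linarith
  simp only [Metric.tendsto_nhds, Real.dist_0_eq_abs]
  exact ⟨fun ε hε => (key ε hε).mono fun x hx => hx.1, fun ε hε => (key ε hε).mono fun x hx => hx.2⟩

theorem tendsto_res_atTop {h : ℝ → ℝ} (hh : Continuous h) {B : ℝ} (hB : ∀ t, |h t| ≤ B) {l : ℝ}
    (hl : Tendsto h atTop (𝓝 l)) :
    Tendsto (resU h) atTop (𝓝 (-(l / 4))) ∧ Tendsto (resV h) atTop (𝓝 0) := by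
  have hc : Continuous fun t => l * (potential t / 4) :=
    (continuous_potential.div_const 4).const_mul l
  have hb : ∀ t, |l * (potential t / 4)| ≤ |l| * 2 := fun t => by
    rw [abs_mul, abs_div, abs_of_pos (by norm_num : (0 : ℝ) < 4)]
    exact mul_le_mul_of_nonneg_left (by linarith [abs_potential_le t]) (abs_nonneg l)
  have ht : Tendsto (fun t => h t - l * (potential t / 4)) atTop (𝓝 0) := by
    have h1 := (((((tendsto_tanh_atTop.pow 2).const_mul 12).sub_const 8).div_const 4).const_mul l)
    have h2 := hl.sub h1
    norm_num at h2
    exact h2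
  obtain ⟨h1, h2⟩ := tendsto_res_atTop_zero (h := fun t => h t - l * (potential t / 4))
    (hh.sub hc) (fun t => (abs_sub _ _).trans (add_le_add (hB t) (hb t))) ht
  constructor
  · have := h1.sub_const (l / 4)
    rw [zero_sub] at this
    refine this.congr fun x => ?_
    rw [(res_sub hh hc hB hb x).1, (res_potential l x).1]; ring
  · refine h2.congr fun x => ?_
    rw [(res_sub hh hc hB hb x).2, (res_potential l x).2]; ring

theorem tendsto_res_atBot {h : ℝ → ℝ} (hh : Continuous h) {B : ℝ} (hB : ∀ t, |h t| ≤ B)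
    (hp : halfPairing (fun t => h (-t)) = halfPairing h) {l : ℝ} (hl : Tendsto h atBot (𝓝 l)) :
    Tendsto (resU h) atBot (𝓝 (-(l / 4))) ∧ Tendsto (resV h) atBot (𝓝 0) := by
  obtain ⟨h1, h2⟩ := tendsto_res_atTop (hh.comp continuous_neg) (fun t => hB (-t))
    (hl.comp tendsto_neg_atTop_atBot)
  constructor
  · refine (h1.comp tendsto_neg_atBot_atTop).congr fun x => ?_
    have := (res_neg hp (-x)).1
    rw [neg_neg] at this
    exact this.symm
  · have h3 := (h2.comp tendsto_neg_atBot_atTop).neg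
    rw [neg_zero] at h3
    refine h3.congr fun x => ?_
    have := (res_neg hp (-x)).2
    rw [neg_neg] at this
    exact this.symm

/-! ### The fixed point problem with projection -/

/-- The multiple of `decSol` that has to be subtracted from `h` to make it orthogonal to
`decSol`; the normalization is `∫ decSol² = 4 / 15`. -/
noncomputable def multiplier (h : ℝ → ℝ) : ℝ := 15 / 4 * ∫ t, decSol t * h t

/-- The projection of `h` along `decSol` onto the orthogonal complement of `decSol`. -/
noncomputable def proj (h : ℝ → ℝ) (x : ℝ) : ℝ := h x - multiplier h * decSol x

theorem abs_integral_decSol_mul_le {h : ℝ → ℝ} {B : ℝ} (hB : ∀ t, |h t| ≤ B) :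
    |∫ t, decSol t * h t| ≤ B := by
  have hi : Integrable fun t => |decSol t| := by
    simpa using (integrable_decSol_mul continuous_const (k := fun _ => 1) (B := 1) (by simp)).abs
  have h1 : ‖∫ t, decSol t * h t‖ ≤ ∫ t, |decSol t| * B := by
    refine norm_integral_le_of_norm_le (hi.mul_const B) (ae_of_all _ fun t => ?_)
    rw [norm_mul]
    exact mul_le_mul_of_nonneg_left (hB t) (abs_nonneg _)
  rwa [integral_mul_const, integral_abs_decSol, one_mul] at h1

theorem abs_multiplier_le {h : ℝ → ℝ} {B : ℝ} (hB : ∀ t, |h t| ≤ B) :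
    |multiplier h| ≤ 15 / 4 * B := by
  rw [multiplier, abs_mul, abs_of_pos (by norm_num : (0 : ℝ) < 15 / 4)]
  exact mul_le_mul_of_nonneg_left (abs_integral_decSol_mul_le hB) (by norm_num)

theorem multiplier_sub {h k : ℝ → ℝ} (hh : Continuous h) (hk : Continuous k) {B C : ℝ}
    (hB : ∀ t, |h t| ≤ B) (hC : ∀ t, |k t| ≤ C) :
    multiplier (fun t => h t - k t) = multiplier h - multiplier k := by
  simp only [multiplier, mul_sub]
  rw [integral_sub (integrable_decSol_mul hh hB) (integrable_decSol_mul hk hC)]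
  ring

theorem continuous_proj {h : ℝ → ℝ} (hh : Continuous h) : Continuous (proj h) :=
  hh.sub (continuous_decSol.const_mul _)

theorem abs_decSol_le_one (x : ℝ) : |decSol x| ≤ 1 :=
  (abs_decSol_le x).trans (one_sub_tanh_sq_le_one x)

theorem abs_proj_le {h : ℝ → ℝ} {B : ℝ} (hB : ∀ t, |h t| ≤ B) (x : ℝ) :
    |proj h x| ≤ 5 * B := by
  have h1 := abs_multiplier_le hB
  have h2 : |multiplier h * decSol x| ≤ 15 / 4 * B * 1 := by
    rw [abs_mul]
    exact mul_le_mul h1 (abs_decSol_le_one x) (abs_nonneg _) ((abs_nonneg _).trans h1)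
  have hB0 : 0 ≤ B := (abs_nonneg _).trans (hB 0)
  refine (abs_sub _ _).trans ((add_le_add (hB x) h2).trans (by linarith))

theorem halfPairing_comp_neg {k : ℝ → ℝ} (hk : Continuous k) {B : ℝ} (hB : ∀ t, |k t| ≤ B)
    (h0 : ∫ t, decSol t * k t = 0) : halfPairing (fun t => k (-t)) = halfPairing k := by
  have hi := integrable_decSol_mul hk hB
  have h1 := intervalIntegral.integral_Iic_add_Ioi (b := 0) hi.integrableOn hi.integrableOn
  have h2 := integral_comp_neg_Ioi (0 : ℝ) (fun t => decSol t * k t)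
  rw [neg_zero] at h2
  rw [h0, ← h2] at h1
  simp only [decSol_neg, neg_mul, integral_neg] at h1
  unfold halfPairing
  linarith

theorem integral_decSol_mul_proj {h : ℝ → ℝ} (hh : Continuous h) {B : ℝ} (hB : ∀ t, |h t| ≤ B) :
    ∫ t, decSol t * proj h t = 0 := by
  have e : (fun t => decSol t * proj h t) =
      fun t => decSol t * h t - multiplier h * (decSol t * decSol t) := by
    funext t; simp only [proj]; ring
  rw [e, integral_sub (integrable_decSol_mul hh hB)
    ((integrable_decSol_mul continuous_decSol abs_decSol_le_one).const_mul _),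
    integral_const_mul, integral_decSol_mul_decSol, multiplier]
  ring

theorem halfPairing_proj {h : ℝ → ℝ} (hh : Continuous h) {B : ℝ} (hB : ∀ t, |h t| ≤ B) :
    halfPairing (fun t => proj h (-t)) = halfPairing (proj h) :=
  halfPairing_comp_neg (continuous_proj hh) (abs_proj_le hB) (integral_decSol_mul_proj hh hB)

theorem tendsto_decSol_atTop : Tendsto decSol atTop (𝓝 0) :=
  squeeze_zero_norm abs_decSol_le tendsto_one_sub_tanh_sq

theorem tendsto_decSol_atBot : Tendsto decSol atBot (𝓝 0) := by
  have h := (tendsto_decSol_atTop.comp tendsto_neg_atBot_atTop).neg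
  rw [neg_zero] at h
  exact h.congr fun x => by simp [Function.comp, decSol_neg]

/-- The pair `(u, u')`, where `u` is the bounded solution on the line of `u'' = q u + proj h` with
`u'(0) = 0`. -/
noncomputable def res (h : ℝ → ℝ) (x : ℝ) : ℝ × ℝ := (resU (proj h) x, resV (proj h) x)

theorem continuous_res {h : ℝ → ℝ} (hh : Continuous h) : Continuous (res h) :=
  continuous_iff_continuousAt.2 fun x =>
    ((hasDerivAt_resU (continuous_proj hh) x).continuousAt).prodMk
      (hasDerivAt_resV (continuous_proj hh) x).continuousAt

theorem norm_res_le {h : ℝ → ℝ} (hh : Continuous h) {B : ℝ} (hB : ∀ t, |h t| ≤ B) (x : ℝ) :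
    ‖res h x‖ ≤ 75 * B := by
  obtain ⟨h1, h2⟩ := abs_res_le (continuous_proj hh) (abs_proj_le hB) (halfPairing_proj hh hB) x
  rw [res, Prod.norm_def]
  exact max_le (h1.trans (by linarith)) (h2.trans (by linarith))

theorem res_sub_res {h k : ℝ → ℝ} (hh : Continuous h) (hk : Continuous k) {B C : ℝ}
    (hB : ∀ t, |h t| ≤ B) (hC : ∀ t, |k t| ≤ C) (x : ℝ) :
    res h x - res k x = res (fun t => h t - k t) x := by
  obtain ⟨h1, h2⟩ := res_sub (continuous_proj hh) (continuous_proj hk) (abs_proj_le hB)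
    (abs_proj_le hC) x
  have e : proj (fun t => h t - k t) = fun t => proj h t - proj k t := by
    funext t; simp only [proj, multiplier_sub hh hk hB hC]; ring
  rw [res, res, res, e, h1, h2]; rfl

theorem tendsto_res_proj_atTop {h : ℝ → ℝ} (hh : Continuous h) {B : ℝ} (hB : ∀ t, |h t| ≤ B)
    {l : ℝ} (hl : Tendsto h atTop (𝓝 l)) : Tendsto (res h) atTop (𝓝 (-(l / 4), 0)) := by
  have ht : Tendsto (proj h) atTop (𝓝 l) := by
    have h0 := hl.sub (tendsto_decSol_atTop.const_mul (multiplier h))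
    rwa [mul_zero, sub_zero] at h0
  obtain ⟨h1, h2⟩ := tendsto_res_atTop (continuous_proj hh) (abs_proj_le hB) ht
  exact h1.prodMk_nhds h2

theorem tendsto_res_proj_atBot {h : ℝ → ℝ} (hh : Continuous h) {B : ℝ} (hB : ∀ t, |h t| ≤ B)
    {l : ℝ} (hl : Tendsto h atBot (𝓝 l)) : Tendsto (res h) atBot (𝓝 (-(l / 4), 0)) := by
  have ht : Tendsto (proj h) atBot (𝓝 l) := by
    have h0 := hl.sub (tendsto_decSol_atBot.const_mul (multiplier h))
    rwa [mul_zero, sub_zero] at h0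
  obtain ⟨h1, h2⟩ := tendsto_res_atBot (continuous_proj hh) (abs_proj_le hB)
    (halfPairing_proj hh hB) ht
  exact h1.prodMk_nhds h2

/-- A right-hand side `N(x, (u, u'))` of the equation `u'' = q u + N`: continuous, Lipschitz with
constant `ε` in `(u, u')`, of size at most `b` at `(u, u') = 0`, and with the same limit
`n (u, u')` at both ends. -/
structure IsRightHandSide (N : ℝ → ℝ × ℝ → ℝ) (n : ℝ × ℝ → ℝ) (ε b : ℝ) : Prop where
  continuous : Continuous fun p : ℝ × (ℝ × ℝ) => N p.1 p.2
  lipschitz : ∀ x a a', |N x a - N x a'| ≤ ε * ‖a - a'‖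
  bound : ∀ x, |N x 0| ≤ b
  tendsto_atTop : ∀ a, Tendsto (fun p : ℝ × (ℝ × ℝ) => N p.1 p.2) (atTop ×ˢ 𝓝 a) (𝓝 (n a))
  tendsto_atBot : ∀ a, Tendsto (fun p : ℝ × (ℝ × ℝ) => N p.1 p.2) (atBot ×ˢ 𝓝 a) (𝓝 (n a))

namespace IsRightHandSide

variable {N : ℝ → ℝ × ℝ → ℝ} {n : ℝ × ℝ → ℝ} {ε b : ℝ}

theorem eps_nonneg (hN : IsRightHandSide N n ε b) : 0 ≤ ε := by
  have h := (abs_nonneg _).trans (hN.lipschitz 0 (1, 0) 0)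
  rw [sub_zero, Prod.norm_def] at h
  simpa using h

theorem continuous_comp (hN : IsRightHandSide N n ε b) (U : ℝ →ᵇ ℝ × ℝ) :
    Continuous fun x => N x (U x) :=
  hN.continuous.comp (continuous_id.prodMk U.continuous)

theorem abs_comp_le (hN : IsRightHandSide N n ε b) (U : ℝ →ᵇ ℝ × ℝ) (x : ℝ) :
    |N x (U x)| ≤ b + ε * ‖U‖ := by
  have h1 := hN.lipschitz x (U x) 0
  rw [sub_zero] at h1
  have h2 := mul_le_mul_of_nonneg_left (U.norm_coe_le_norm x) hN.eps_nonneg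
  have h3 := abs_add_le (N x (U x) - N x 0) (N x 0)
  rw [sub_add_cancel] at h3
  linarith [hN.bound x]

/-- The operator whose fixed points are the solutions of `u'' = q u + proj (N (·, (u, u')))`. -/
noncomputable def solveMap (hN : IsRightHandSide N n ε b) (U : ℝ →ᵇ ℝ × ℝ) : ℝ →ᵇ ℝ × ℝ :=
  BoundedContinuousFunction.ofNormedAddCommGroup (res fun x => N x (U x))
    (continuous_res (hN.continuous_comp U)) _
    (norm_res_le (hN.continuous_comp U) (hN.abs_comp_le U))

theorem solveMap_apply (hN : IsRightHandSide N n ε b) (U : ℝ →ᵇ ℝ × ℝ) (x : ℝ) :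
    hN.solveMap U x = res (fun x => N x (U x)) x := rfl

theorem norm_solveMap_sub_le {N' : ℝ → ℝ × ℝ → ℝ} {n' : ℝ × ℝ → ℝ} {b' δ : ℝ}
    (hN : IsRightHandSide N n ε b) (hN' : IsRightHandSide N' n' ε b')
    (hδ : ∀ x a, |N x a - N' x a| ≤ δ) (U U' : ℝ →ᵇ ℝ × ℝ) :
    ‖hN.solveMap U - hN'.solveMap U'‖ ≤ 75 * (ε * ‖U - U'‖ + δ) := by
  have hδ0 : 0 ≤ δ := (abs_nonneg _).trans (hδ 0 0)
  have hε := hN.eps_nonneg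
  refine (BoundedContinuousFunction.norm_le (by positivity)).2 fun x => ?_
  rw [BoundedContinuousFunction.sub_apply, solveMap_apply, solveMap_apply,
    res_sub_res (hN.continuous_comp U) (hN'.continuous_comp U') (hN.abs_comp_le U)
      (hN'.abs_comp_le U')]
  refine norm_res_le ((hN.continuous_comp U).sub (hN'.continuous_comp U')) (fun t => ?_) x
  have h1 := hN.lipschitz t (U t) (U' t)
  have h2 := mul_le_mul_of_nonneg_left ((U - U').norm_coe_le_norm t) hε
  rw [BoundedContinuousFunction.sub_apply] at h2
  have h3 := abs_add_le (N t (U t) - N t (U' t)) (N t (U' t) - N' t (U' t))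
  rw [sub_add_sub_cancel] at h3
  have h4 : |N t (U t) - N' t (U' t)| ≤ ε * ‖U - U'‖ + δ := by linarith [hδ t (U' t)]
  exact h4

/-- The solution operator has norm at most `75`, so `ε ≤ 1 / 150` gives the contraction constant
`1 / 2`. -/
theorem contracting_solveMap (hN : IsRightHandSide N n ε b) (hε : ε ≤ 1 / 150) :
    ContractingWith (1 / 2) hN.solveMap := by
  refine ⟨by rw [← NNReal.coe_lt_coe]; norm_num, LipschitzWith.of_dist_le_mul fun U U' => ?_⟩
  rw [dist_eq_norm, dist_eq_norm]
  have h := hN.norm_solveMap_sub_le hN (δ := 0) (fun x a => by simp) U U'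
  have := norm_nonneg (U - U')
  push_cast
  nlinarith

/-- The set of bounded continuous functions with limits at both ends is closed. -/
theorem isClosed_cauchySeq :
    IsClosed {U : ℝ →ᵇ ℝ × ℝ | CauchySeq U ∧ CauchySeq fun x => U (-x)} := by
  have key : ∀ f : ℝ → ℝ, IsClosed {U : ℝ →ᵇ ℝ × ℝ | CauchySeq fun x => U (f x)} := by
    intro f
    refine isClosed_of_closure_subset fun U hU => Metric.cauchySeq_iff.2 fun ε hε => ?_
    obtain ⟨V, hV, hd⟩ := Metric.mem_closure_iff.1 hU (ε / 3) (by positivity)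
    obtain ⟨a, ha⟩ := Metric.cauchySeq_iff.1 hV (ε / 3) (by positivity)
    refine ⟨a, fun x hx y hy => ?_⟩
    have h1 := BoundedContinuousFunction.dist_coe_le_dist (f := U) (g := V) (f x)
    have h2 := BoundedContinuousFunction.dist_coe_le_dist (f := U) (g := V) (f y)
    have h3 := ha x hx y hy
    have h4 := dist_triangle4_right (U (f x)) (U (f y)) (V (f x)) (V (f y))
    linarith
  exact (key id).inter (key Neg.neg)

theorem tendsto_solveMap_atTop (hN : IsRightHandSide N n ε b) {U : ℝ →ᵇ ℝ × ℝ} {a : ℝ × ℝ}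
    (hU : Tendsto U atTop (𝓝 a)) : Tendsto (hN.solveMap U) atTop (𝓝 (-(n a / 4), 0)) :=
  tendsto_res_proj_atTop (hN.continuous_comp U) (hN.abs_comp_le U)
    ((hN.tendsto_atTop a).comp (tendsto_id.prodMk hU))

theorem tendsto_solveMap_atBot (hN : IsRightHandSide N n ε b) {U : ℝ →ᵇ ℝ × ℝ} {a : ℝ × ℝ}
    (hU : Tendsto U atBot (𝓝 a)) : Tendsto (hN.solveMap U) atBot (𝓝 (-(n a / 4), 0)) :=
  tendsto_res_proj_atBot (hN.continuous_comp U) (hN.abs_comp_le U)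
    ((hN.tendsto_atBot a).comp (tendsto_id.prodMk hU))

theorem exists_fixed (hN : IsRightHandSide N n ε b) (hε : ε ≤ 1 / 150) :
    ∃ U : ℝ →ᵇ ℝ × ℝ, hN.solveMap U = U := by
  have : Nonempty (ℝ →ᵇ ℝ × ℝ) := ⟨0⟩
  exact ⟨_, (hN.contracting_solveMap hε).fixedPoint_isFixedPt⟩

/-- The fixed point depends on the right-hand side in a Lipschitz way. -/
theorem norm_sub_le_of_fixed {N' : ℝ → ℝ × ℝ → ℝ} {n' : ℝ × ℝ → ℝ} {b' δ : ℝ}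
    (hε : ε ≤ 1 / 150) (hN : IsRightHandSide N n ε b) (hN' : IsRightHandSide N' n' ε b')
    (hδ : ∀ x a, |N x a - N' x a| ≤ δ) {U U' : ℝ →ᵇ ℝ × ℝ} (hU : hN.solveMap U = U)
    (hU' : hN'.solveMap U' = U') : ‖U - U'‖ ≤ 150 * δ := by
  have h := norm_solveMap_sub_le hN hN' hδ U U'
  rw [hU, hU'] at h
  have := norm_nonneg (U - U')
  nlinarith

theorem norm_le_of_fixed (hε : ε ≤ 1 / 150) (hN : IsRightHandSide N n ε b) {U : ℝ →ᵇ ℝ × ℝ}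
    (hU : hN.solveMap U = U) : ‖U‖ ≤ 150 * b := by
  have hb : 0 ≤ b := (abs_nonneg _).trans (hN.bound 0)
  have h : ‖hN.solveMap U‖ ≤ 75 * (b + ε * ‖U‖) :=
    (BoundedContinuousFunction.norm_le (by have := hN.eps_nonneg; positivity)).2 fun x =>
      norm_res_le (hN.continuous_comp U) (hN.abs_comp_le U) x
  rw [hU] at h
  have := norm_nonneg U
  nlinarith

/-- The solution tends to one and the same limit at both ends: the limits exist because the
operator preserves the closed set of functions with limits, and both satisfy the equation
`4 u + n (u, 0) = 0`, which has at most one solution. -/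
theorem exists_tendsto_of_fixed (hε : ε ≤ 1 / 150) (hN : IsRightHandSide N n ε b)
    {U : ℝ →ᵇ ℝ × ℝ} (hU : hN.solveMap U = U) :
    ∃ l : ℝ, 4 * l + n (l, 0) = 0 ∧ Tendsto U atTop (𝓝 (l, 0)) ∧
      Tendsto U atBot (𝓝 (l, 0)) := by
  have : Nonempty (ℝ →ᵇ ℝ × ℝ) := ⟨0⟩
  have hcon := hN.contracting_solveMap hε
  have hmem : U ∈ {U : ℝ →ᵇ ℝ × ℝ | CauchySeq U ∧ CauchySeq fun x => U (-x)} := by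
    have ht := hcon.tendsto_iterate_fixedPoint 0
    rw [← hcon.fixedPoint_unique hU] at ht
    refine isClosed_cauchySeq.mem_of_tendsto ht (Eventually.of_forall fun k => ?_)
    induction k with
    | zero =>
      rw [Function.iterate_zero, id]
      exact ⟨tendsto_const_nhds.cauchySeq (x := (0 : ℝ × ℝ)),
        tendsto_const_nhds.cauchySeq (x := (0 : ℝ × ℝ))⟩
    | succ k ih =>
      rw [Function.iterate_succ_apply']
      obtain ⟨a, ha⟩ := cauchySeq_tendsto_of_complete ih.1
      obtain ⟨a', ha'⟩ := cauchySeq_tendsto_of_complete ih.2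
      have hb := ha'.comp tendsto_neg_atBot_atTop
      simp only [Function.comp_def, neg_neg] at hb
      exact ⟨(hN.tendsto_solveMap_atTop ha).cauchySeq,
        ((hN.tendsto_solveMap_atBot hb).comp tendsto_neg_atTop_atBot).cauchySeq⟩
  obtain ⟨a, ha⟩ := cauchySeq_tendsto_of_complete hmem.1
  obtain ⟨a', ha'⟩ := cauchySeq_tendsto_of_complete hmem.2
  have hb := ha'.comp tendsto_neg_atBot_atTop
  simp only [Function.comp_def, neg_neg] at hb
  have e1 := hN.tendsto_solveMap_atTop ha
  have e2 := hN.tendsto_solveMap_atBot hb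
  rw [hU] at e1 e2
  have f1 := tendsto_nhds_unique ha e1
  have f2 := tendsto_nhds_unique hb e2
  have hn : ‖n a - n a'‖ ≤ ε * ‖a - a'‖ := by
    have t1 := (hN.tendsto_atTop a).comp (tendsto_id.prodMk (tendsto_const_nhds (x := a)))
    have t2 := (hN.tendsto_atTop a').comp (tendsto_id.prodMk (tendsto_const_nhds (x := a')))
    exact le_of_tendsto (t1.sub t2).norm (Eventually.of_forall fun x => hN.lipschitz x a a')
  have haa : ‖a - a'‖ = ‖n a - n a'‖ / 4 := by
    rw [f1, f2, Prod.norm_def]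
    simp only [Prod.mk_sub_mk, sub_zero, norm_zero]
    rw [max_eq_left (norm_nonneg _), ← f1, ← f2, Real.norm_eq_abs, Real.norm_eq_abs,
      ← abs_neg, ← abs_of_pos (by norm_num : (0 : ℝ) < 4), ← abs_div]
    congr 1
    rw [abs_of_pos (by norm_num : (0 : ℝ) < 4)]
    ring
  have h0 : ‖a - a'‖ = 0 := by
    have := norm_nonneg (a - a')
    nlinarith
  have heq : a = a' := sub_eq_zero.1 (norm_eq_zero.1 h0)
  refine ⟨-(n a / 4), ?_, e1, ?_⟩
  · rw [← f1]; ring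
  · rw [heq]; exact e2

end IsRightHandSide

/-! ### The normalized Melnikov theorem -/

/-- The truncation of a real number to `[-r, r]`. -/
noncomputable def clip (r a : ℝ) : ℝ := max (-r) (min r a)

theorem continuous_clip (r : ℝ) : Continuous (clip r) := by unfold clip; fun_prop

theorem abs_clip_le {r : ℝ} (hr : 0 ≤ r) (a : ℝ) : |clip r a| ≤ r :=
  abs_le.2 ⟨le_max_left _ _, max_le (by linarith) (min_le_left _ _)⟩

theorem abs_clip_sub_clip_le (r a b : ℝ) : |clip r a - clip r b| ≤ |a - b| := by
  refine (abs_max_sub_max_le_max _ _ _ _).trans ?_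
  rw [sub_self, abs_zero]
  refine max_le (abs_nonneg _) ((abs_min_sub_min_le_max _ _ _ _).trans ?_)
  rw [sub_self, abs_zero]
  exact max_le (abs_nonneg _) le_rfl

theorem clip_eq_self {r a : ℝ} (h : |a| ≤ r) : clip r a = a := by
  rw [clip, min_eq_right (abs_le.1 h).2, max_eq_right (abs_le.1 h).1]

/-- Componentwise truncation in the plane. -/
noncomputable def clipPair (r : ℝ) (a : ℝ × ℝ) : ℝ × ℝ := (clip r a.1, clip r a.2)

theorem continuous_clipPair (r : ℝ) : Continuous (clipPair r) :=
  ((continuous_clip r).comp continuous_fst).prodMk ((continuous_clip r).comp continuous_snd)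

theorem norm_clipPair_le {r : ℝ} (hr : 0 ≤ r) (a : ℝ × ℝ) : ‖clipPair r a‖ ≤ r :=
  max_le (abs_clip_le hr _) (abs_clip_le hr _)

theorem norm_clipPair_sub_le (r : ℝ) (a b : ℝ × ℝ) : ‖clipPair r a - clipPair r b‖ ≤ ‖a - b‖ :=
  max_le_max (abs_clip_sub_clip_le _ _ _) (abs_clip_sub_clip_le _ _ _)

theorem clipPair_eq_self {r : ℝ} {a : ℝ × ℝ} (h : ‖a‖ ≤ r) : clipPair r a = a :=
  Prod.ext (clip_eq_self ((le_max_left _ _).trans h)) (clip_eq_self ((le_max_right _ _).trans h))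

/-- The homoclinic solution `(w, w')`, `w = 2 - 3 tanh²`, of `w'' = 2 (1 - w²)`. -/
noncomputable def normalLoop (x : ℝ) : ℝ × ℝ := (2 - 3 * Real.tanh x ^ 2, -6 * decSol x)

theorem continuous_normalLoop : Continuous normalLoop :=
  (continuous_const.sub ((continuous_tanh.pow 2).const_mul 3)).prodMk
    (continuous_decSol.const_mul (-6))

theorem hasDerivAt_normalLoop (x : ℝ) :
    HasDerivAt normalLoop ((normalLoop x).2, 2 * (1 - (normalLoop x).1 ^ 2)) x := by
  refine HasDerivAt.prodMk ?_ ?_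
  · refine (((hasDerivAt_tanh x).pow 2).const_mul 3 |>.const_sub 2).congr_deriv ?_
    simp only [normalLoop, decSol]; push_cast; ring
  · refine ((hasDerivAt_decSol x).const_mul (-6)).congr_deriv ?_
    simp only [normalLoop, decSolDeriv]; ring

theorem norm_normalLoop_le (x : ℝ) : ‖normalLoop x‖ ≤ 6 := by
  refine max_le ?_ ?_
  · rw [Real.norm_eq_abs, abs_le]
    have := tanh_sq_lt_one x
    have := sq_nonneg (Real.tanh x)
    constructor <;> simp only [normalLoop] <;> linarith
  · have := abs_decSol_le_one x
    simp only [normalLoop, norm_mul, Real.norm_eq_abs]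
    norm_num
    linarith

theorem tendsto_normalLoop_atTop : Tendsto normalLoop atTop (𝓝 (-1, 0)) := by
  have h := (((tendsto_tanh_atTop.pow 2).const_mul 3).const_sub 2).prodMk_nhds
    (tendsto_decSol_atTop.const_mul (-6))
  rwa [show ((2 - 3 * 1 ^ 2, -6 * 0) : ℝ × ℝ) = (-1, 0) by norm_num] at h

theorem tendsto_normalLoop_atBot : Tendsto normalLoop atBot (𝓝 (-1, 0)) := by
  have h := (((tendsto_tanh_atBot.pow 2).const_mul 3).const_sub 2).prodMk_nhds
    (tendsto_decSol_atBot.const_mul (-6))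
  rwa [show ((2 - 3 * (-1) ^ 2, -6 * 0) : ℝ × ℝ) = (-1, 0) by norm_num] at h

theorem isCompact_closure_normalLoop : IsCompact (closure (Set.range normalLoop)) := by
  refine Metric.isCompact_of_isClosed_isBounded isClosed_closure (Bornology.IsBounded.closure ?_)
  refine Metric.isBounded_closedBall.subset (t := Metric.closedBall 0 6) ?_
  rintro _ ⟨x, rfl⟩
  simpa using norm_normalLoop_le x

theorem saddle_mem_closure_normalLoop : ((-1, 0) : ℝ × ℝ) ∈ closure (Set.range normalLoop) :=
  mem_closure_of_tendsto tendsto_normalLoop_atTop (Eventually.of_forall fun x => ⟨x, rfl⟩)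

/-- A `C¹` function is bounded and Lipschitz on the balls of a uniform radius about the points of
a compact subset of its domain. -/
theorem exists_uniform_lipschitz {E : Type*} [NormedAddCommGroup E] [NormedSpace ℝ E]
    [ProperSpace E] {G : E → ℝ} {W K : Set E} (hW : IsOpen W) (hG : ContDiffOn ℝ 1 G W)
    (hK : IsCompact K) (hKW : K ⊆ W) :
    ∃ r > 0, ∃ L ≥ 0, ∃ B ≥ 0, ∀ k ∈ K, ∀ p ∈ Metric.closedBall k r,
      p ∈ W ∧ |G p| ≤ B ∧ ∀ q ∈ Metric.closedBall k r, |G p - G q| ≤ L * ‖p - q‖ := by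
  obtain ⟨r, hr, hrW⟩ := hK.exists_cthickening_subset_open hW hKW
  have hKc : IsCompact (Metric.cthickening r K) := hK.cthickening
  obtain ⟨L, hL⟩ := hKc.exists_bound_of_continuousOn
    ((hG.continuousOn_fderiv_of_isOpen hW le_rfl).mono hrW)
  obtain ⟨B, hB⟩ := hKc.exists_bound_of_continuousOn (hG.continuousOn.mono hrW)
  refine ⟨r, hr, max L 0, le_max_right _ _, max B 0, le_max_right _ _, fun k hk p hp => ?_⟩
  have hsub : Metric.closedBall k r ⊆ Metric.cthickening r K :=
    Metric.closedBall_subset_cthickening hk r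
  refine ⟨hrW (hsub hp), (hB p (hsub hp)).trans (le_max_left _ _), fun q hq => ?_⟩
  refine (convex_closedBall k r).norm_image_sub_le_of_norm_fderiv_le (𝕜 := ℝ) (fun z hz => ?_)
    (fun z hz => (hL z (hsub hz)).trans (le_max_left L 0)) hq hp
  exact (hG.differentiableOn one_ne_zero).differentiableAt (hW.mem_nhds (hrW (hsub hz)))

/-- The right-hand side `-2 u² + τ G (w + u, w' + u', c, τ)` of the equation for the difference
`u` to the normalized loop `w`, truncated so that it is globally defined. -/
noncomputable def loopRhs (G : (ℝ × ℝ) × ℝ × ℝ → ℝ) (r c τ x : ℝ) (a : ℝ × ℝ) : ℝ :=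
  -2 * (clipPair r a).1 ^ 2 + τ * G (normalLoop x + clipPair r a, c, τ)

section LoopRhs

variable {G : (ℝ × ℝ) × ℝ × ℝ → ℝ} {W : Set ((ℝ × ℝ) × ℝ × ℝ)} {c₀ r L B : ℝ}

theorem mem_closedBall_tube {k a : ℝ × ℝ} {c τ : ℝ} (ha : ‖a‖ ≤ r) (hc : |c - c₀| ≤ r)
    (hτ : 0 ≤ τ) (hτr : τ ≤ r) : (k + a, c, τ) ∈ Metric.closedBall (k, c₀, (0 : ℝ)) r := by
  rw [mem_closedBall_iff_norm]
  simp only [Prod.mk_sub_mk, add_sub_cancel_left, sub_zero, Prod.norm_mk, Real.norm_eq_abs,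
    abs_of_nonneg hτ]
  exact max_le ha (max_le hc hτr)

/-- The truncation at `r ≤ 1 / 1200` makes the quadratic term Lipschitz with constant `4 r ≤ 1 / 300`;
smallness of `τ` does the same for the perturbation. -/
theorem isRightHandSide_loopRhs (hW : IsOpen W) (hG : ContDiffOn ℝ 1 G W) (hr0 : 0 ≤ r)
    (hr : r ≤ 1 / 1200)
    (hT : ∀ k ∈ closure (Set.range normalLoop), ∀ p ∈ Metric.closedBall (k, c₀, (0 : ℝ)) r,
      p ∈ W ∧ |G p| ≤ B ∧
        ∀ q ∈ Metric.closedBall (k, c₀, (0 : ℝ)) r, |G p - G q| ≤ L * ‖p - q‖)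
    {c τ : ℝ} (hc : |c - c₀| ≤ r) (hτ : 0 ≤ τ) (hτr : τ ≤ r) (hτL : τ * L ≤ 1 / 300) :
    IsRightHandSide (loopRhs G r c τ)
      (fun a => -2 * (clipPair r a).1 ^ 2 + τ * G ((-1, 0) + clipPair r a, c, τ))
      (1 / 150) (τ * B) := by
  have hball : ∀ k a, (k + clipPair r a, c, τ) ∈ Metric.closedBall (k, c₀, (0 : ℝ)) r :=
    fun k a => mem_closedBall_tube (norm_clipPair_le hr0 a) hc hτ hτr
  have hx : ∀ x, normalLoop x ∈ closure (Set.range normalLoop) :=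
    fun x => subset_closure ⟨x, rfl⟩
  have hlim : ∀ (F : Filter ℝ), Tendsto normalLoop F (𝓝 (-1, 0)) → ∀ a : ℝ × ℝ,
      Tendsto (fun p : ℝ × (ℝ × ℝ) => loopRhs G r c τ p.1 p.2) (F ×ˢ 𝓝 a)
        (𝓝 (-2 * (clipPair r a).1 ^ 2 + τ * G ((-1, 0) + clipPair r a, c, τ))) := by
    intro F hF a
    have h1 : Tendsto (fun p : ℝ × (ℝ × ℝ) => clipPair r p.2) (F ×ˢ 𝓝 a) (𝓝 (clipPair r a)) :=
      ((continuous_clipPair r).tendsto a).comp tendsto_snd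
    have h2 : Tendsto (fun p : ℝ × (ℝ × ℝ) => normalLoop p.1) (F ×ˢ 𝓝 a) (𝓝 (-1, 0)) :=
      hF.comp tendsto_fst
    have h3 : ContinuousAt G ((-1, 0) + clipPair r a, c, τ) :=
      hG.continuousOn.continuousAt
        (hW.mem_nhds (hT _ saddle_mem_closure_normalLoop _ (hball _ a)).1)
    have h4 := h3.tendsto.comp ((h2.add h1).prodMk_nhds
      ((tendsto_const_nhds (x := c)).prodMk_nhds (tendsto_const_nhds (x := τ))))
    have h5 := (continuous_fst.tendsto _).comp h1
    exact ((h5.pow 2).const_mul (-2)).add (h4.const_mul τ)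
  refine ⟨?_, fun x a a' => ?_, fun x => ?_, hlim _ tendsto_normalLoop_atTop,
    hlim _ tendsto_normalLoop_atBot⟩
  · have h1 : Continuous fun p : ℝ × (ℝ × ℝ) => clipPair r p.2 :=
      (continuous_clipPair r).comp continuous_snd
    have h2 : Continuous fun p : ℝ × (ℝ × ℝ) => (normalLoop p.1 + clipPair r p.2, c, τ) :=
      ((continuous_normalLoop.comp continuous_fst).add h1).prodMk continuous_const
    have h3 := hG.continuousOn.comp_continuous h2
      fun p => (hT _ (hx p.1) _ (hball _ p.2)).1
    exact (((continuous_fst.comp h1).pow 2).const_mul (-2)).add (h3.const_mul τ)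
  · have h1 := (hT _ (hx x) _ (hball _ a)).2.2 _ (hball _ a')
    have h2 := norm_clipPair_sub_le r a a'
    have e : ‖(normalLoop x + clipPair r a, c, τ) - (normalLoop x + clipPair r a', c, τ)‖
        = ‖clipPair r a - clipPair r a'‖ := by
      simp [Prod.norm_mk]
    rw [e] at h1
    have h3 : |(clipPair r a).1 - (clipPair r a').1| ≤ ‖clipPair r a - clipPair r a'‖ :=
      le_max_left _ _
    have h4 : |(clipPair r a).1 + (clipPair r a').1| ≤ 2 * r := by
      refine (abs_add_le _ _).trans ?_
      have := abs_clip_le hr0 a.1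
      have := abs_clip_le hr0 a'.1
      simp only [clipPair]; linarith
    have e2 : loopRhs G r c τ x a - loopRhs G r c τ x a' =
        -2 * (((clipPair r a).1 + (clipPair r a').1) * ((clipPair r a).1 - (clipPair r a').1))
        + τ * (G (normalLoop x + clipPair r a, c, τ) - G (normalLoop x + clipPair r a', c, τ)) := by
      simp only [loopRhs]; ring
    rw [e2]
    refine (abs_add_le _ _).trans ?_
    rw [abs_mul, abs_mul, abs_mul, abs_of_nonneg hτ, abs_neg, abs_two]
    have h5 := mul_le_mul h4 h3 (abs_nonneg _) (by positivity)
    have h6 := mul_le_mul_of_nonneg_left h1 hτ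
    have h7 : (4 * r + τ * L) * ‖clipPair r a - clipPair r a'‖ ≤ 1 / 150 * ‖a - a'‖ :=
      mul_le_mul (by linarith) h2 (norm_nonneg _) (by norm_num)
    linarith
  · have h0 : clipPair r 0 = 0 := clipPair_eq_self (by simpa using hr0)
    have h1 := (hT _ (hx x) _ (hball _ 0)).2.1
    simp only [loopRhs]
    rw [h0] at h1 ⊢
    rw [Prod.fst_zero, zero_pow two_ne_zero, mul_zero, zero_add, abs_mul, abs_of_nonneg hτ]
    exact mul_le_mul_of_nonneg_left h1 hτ

end LoopRhs

/-- A continuous function on an interval about `c₀` that differs from the linear function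
`k (c - c₀)` by no more than the values of the latter at the end points has a zero. -/
theorem exists_eq_zero_of_approx {c₀ d k : ℝ} (hd : 0 ≤ d)
    {f : Set.Icc (c₀ - d) (c₀ + d) → ℝ} (hf : Continuous f)
    (h : ∀ c, |f c - k * (c - c₀)| ≤ |k| * d) : ∃ c, f c = 0 := by
  by_cases hk : k = 0
  · exact ⟨⟨c₀, by linarith, by linarith⟩, by simpa [hk] using h ⟨c₀, by linarith, by linarith⟩⟩
  have hle : c₀ - d ≤ c₀ + d := by linarith
  have hkk : |k| * |k| = k * k := abs_mul_abs_self k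
  have hmul : ∀ c, |k * (f c - k * (c - c₀))| ≤ k * k * d := fun c => by
    rw [abs_mul, ← hkk, mul_assoc]
    exact mul_le_mul_of_nonneg_left (h c) (abs_nonneg k)
  have hneg : k * f ⟨c₀ - d, le_rfl, hle⟩ ≤ 0 := by
    have := (abs_le.1 (hmul ⟨c₀ - d, le_rfl, hle⟩)).2
    simp only at this
    linarith
  have hpos : 0 ≤ k * f ⟨c₀ + d, hle, le_rfl⟩ := by
    have := (abs_le.1 (hmul ⟨c₀ + d, hle, le_rfl⟩)).1
    simp only at this
    linarith
  have : PreconnectedSpace (Set.Icc (c₀ - d) (c₀ + d)) :=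
    isPreconnected_iff_preconnectedSpace.1 isPreconnected_Icc
  obtain ⟨c, hc⟩ := mem_range_of_exists_le_of_exists_ge (hf.const_mul k) ⟨_, hneg⟩ ⟨_, hpos⟩
  exact ⟨c, (mul_eq_zero.1 hc).resolve_left hk⟩

/-- The Melnikov theorem for the normalized equation `w'' = 2 (1 - w²) + τ G (w, w', c, τ)`: near a
simple zero `c₀` of the Melnikov function there are, for small `τ > 0`, parameters
`c = c₀ + O(τ)` with a homoclinic solution at distance `O(τ)` from the unperturbed one. -/
theorem exists_homoclinic_normalized {G : (ℝ × ℝ) × ℝ × ℝ → ℝ} {W : Set ((ℝ × ℝ) × ℝ × ℝ)}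
    (hW : IsOpen W) (hG : ContDiffOn ℝ 1 G W) {c₀ : ℝ}
    (hK : ∀ k ∈ closure (Set.range normalLoop), (k, c₀, (0 : ℝ)) ∈ W) {m' : ℝ}
    (hm0 : ∫ x, decSol x * G (normalLoop x, c₀, 0) = 0)
    (hm : HasDerivAt (fun c => ∫ x, decSol x * G (normalLoop x, c, 0)) m' c₀) (hm' : m' ≠ 0) :
    ∃ Q A : ℝ, ∀ᶠ τ in 𝓝[>] (0 : ℝ), ∃ c : ℝ, |c - c₀| ≤ Q * τ ∧ ∃ (Y : ℝ → ℝ × ℝ) (l : ℝ),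
      (∀ x, ‖Y x - normalLoop x‖ ≤ A * τ) ∧
      (∀ x, (Y x, c, τ) ∈ W) ∧ ((l, 0), c, τ) ∈ W ∧
      2 * (1 - l ^ 2) + τ * G ((l, 0), c, τ) = 0 ∧
      (∀ x, HasDerivAt Y ((Y x).2, 2 * (1 - (Y x).1 ^ 2) + τ * G (Y x, c, τ)) x) ∧
      Tendsto Y atTop (𝓝 (l, 0)) ∧ Tendsto Y atBot (𝓝 (l, 0)) := by
  obtain ⟨r, hr0, hr, L, hL0, B, hB0, hT⟩ : ∃ r > 0, r ≤ 1 / 1200 ∧ ∃ L ≥ 0, ∃ B ≥ 0,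
      ∀ k ∈ closure (Set.range normalLoop), ∀ p ∈ Metric.closedBall (k, c₀, (0 : ℝ)) r,
      p ∈ W ∧ |G p| ≤ B ∧
        ∀ q ∈ Metric.closedBall (k, c₀, (0 : ℝ)) r, |G p - G q| ≤ L * ‖p - q‖ := by
    obtain ⟨r, hr, L, hL, B, hB, h⟩ := exists_uniform_lipschitz hW hG
      (isCompact_closure_normalLoop.image (f := fun k => (k, c₀, (0 : ℝ))) (by fun_prop))
      (by rintro _ ⟨k, hk, rfl⟩; exact hK k hk)
    have hsub : ∀ k : (ℝ × ℝ) × ℝ × ℝ,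
        Metric.closedBall k (min r (1 / 1200)) ⊆ Metric.closedBall k r :=
      fun k => Metric.closedBall_subset_closedBall (min_le_left _ _)
    refine ⟨min r (1 / 1200), lt_min hr (by norm_num), min_le_right _ _, L, hL, B, hB,
      fun k hk p hp => ?_⟩
    obtain ⟨h1, h2, h3⟩ := h _ ⟨k, hk, rfl⟩ p (hsub _ hp)
    exact ⟨h1, h2, fun q hq => h3 q (hsub _ hq)⟩
  -- The error of the approximation of the bifurcation function by `τ` times the Melnikov
  -- function is at most `C τ²`, up to the factor `15 / 4`.
  obtain ⟨C, hC⟩ : ∃ C, C = 2 * (150 * B) ^ 2 + L * (150 * B + 1) := ⟨_, rfl⟩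
  have hC0 : 0 ≤ C := by rw [hC]; positivity
  -- At distance `Q τ` from `c₀` the Melnikov function is at least the error `C τ`.
  obtain ⟨Q, hQ⟩ : ∃ Q, Q = 2 * C / |m'| := ⟨_, rfl⟩
  have hm'0 : 0 < |m'| := abs_pos.2 hm'
  have hQ0 : 0 ≤ Q := by rw [hQ]; positivity
  obtain ⟨η, hη0, hη⟩ : ∃ η > 0, ∀ c, |c - c₀| < η →
      |(∫ x, decSol x * G (normalLoop x, c, 0)) - m' * (c - c₀)| ≤ |m'| / 2 * |c - c₀| := by
    have h := hm.hasFDerivAt.isLittleO.def (half_pos hm'0)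
    obtain ⟨η, hη0, hη⟩ := Metric.eventually_nhds_iff.1 h
    refine ⟨η, hη0, fun c hc => ?_⟩
    have := hη (y := c) (by rwa [Real.dist_eq])
    simpa [hm0, mul_comm] using this
  refine ⟨Q, 150 * B, ?_⟩
  have hsmall : ∀ (b : ℝ), ∀ ε > 0, ∀ᶠ τ in 𝓝[>] (0 : ℝ), τ * b < ε := fun b ε hε => by
    have : Tendsto (fun τ : ℝ => τ * b) (𝓝[>] 0) (𝓝 (0 * b)) :=
      (tendsto_id.mul_const b).mono_left nhdsWithin_le_nhds
    exact (tendsto_order.1 this).2 ε (by rwa [zero_mul])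
  filter_upwards [self_mem_nhdsWithin, hsmall 1 r hr0, hsmall L (1 / 300) (by norm_num),
    hsmall Q r hr0, hsmall Q η hη0, hsmall (150 * B) r hr0] with τ hτpos hτr hτL hτQr hτQη hτB
  rw [mul_one] at hτr
  have hτ : 0 ≤ τ := le_of_lt hτpos
  have hx : ∀ x, normalLoop x ∈ closure (Set.range normalLoop) :=
    fun x => subset_closure ⟨x, rfl⟩
  have hN : ∀ c : Set.Icc (c₀ - Q * τ) (c₀ + Q * τ), IsRightHandSide (loopRhs G r c τ)
      (fun a => -2 * (clipPair r a).1 ^ 2 + τ * G ((-1, 0) + clipPair r a, c, τ))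
      (1 / 150) (τ * B) := fun c =>
    isRightHandSide_loopRhs hW hG hr0.le hr hT
      (abs_le.2 ⟨by linarith [c.2.1], by linarith [c.2.2]⟩) hτ hτr.le hτL.le
  have hcr : ∀ c : Set.Icc (c₀ - Q * τ) (c₀ + Q * τ), |(c : ℝ) - c₀| ≤ r := fun c =>
    abs_le.2 ⟨by linarith [c.2.1], by linarith [c.2.2]⟩
  choose U hU using fun c => (hN c).exists_fixed le_rfl
  have hUn : ∀ c, ‖U c‖ ≤ 150 * (τ * B) := fun c =>
    IsRightHandSide.norm_le_of_fixed le_rfl (hN c) (hU c)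
  -- The bifurcation function: its zeros are the `c` for which the projection changes nothing.
  obtain ⟨lam, hlam⟩ : ∃ lam : Set.Icc (c₀ - Q * τ) (c₀ + Q * τ) → ℝ,
      lam = fun c : Set.Icc (c₀ - Q * τ) (c₀ + Q * τ) => multiplier fun x => loopRhs G r c τ x (U c x) := ⟨_, rfl⟩
  have hcont : Continuous lam := by
    have hlip : ∀ c d, dist (lam c) (lam d) ≤ 15 / 2 * (τ * L) * dist c d := by
      intro c d
      have hδ : ∀ x a, |loopRhs G r c τ x a - loopRhs G r d τ x a| ≤
          τ * L * |(c : ℝ) - d| := fun x a => by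
        have h := (hT _ (hx x) _ (mem_closedBall_tube (norm_clipPair_le hr0.le a) (hcr c) hτ
          hτr.le)).2.2 _ (mem_closedBall_tube (norm_clipPair_le hr0.le a) (hcr d) hτ hτr.le)
        have e : ‖(normalLoop x + clipPair r a, (c : ℝ), τ)
            - (normalLoop x + clipPair r a, (d : ℝ), τ)‖ = |(c : ℝ) - d| := by
          simp [Prod.norm_mk]
        rw [e] at h
        simp only [loopRhs]
        rw [add_sub_add_left_eq_sub, ← mul_sub, abs_mul, abs_of_nonneg hτ, mul_assoc]
        exact mul_le_mul_of_nonneg_left h hτ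
      have h1 := IsRightHandSide.norm_sub_le_of_fixed le_rfl (hN c) (hN d) hδ (hU c) (hU d)
      rw [hlam, Real.dist_eq, ← multiplier_sub ((hN c).continuous_comp (U c))
        ((hN d).continuous_comp (U d)) ((hN c).abs_comp_le (U c)) ((hN d).abs_comp_le (U d))]
      refine (abs_multiplier_le (B := 2 * (τ * L * |(c : ℝ) - d|)) fun x => ?_).trans
        (le_of_eq (by rw [Subtype.dist_eq, Real.dist_eq]; ring))
      have h2 := (hN c).lipschitz x (U c x) (U d x)
      have h3 := (U c - U d).norm_coe_le_norm x
      rw [BoundedContinuousFunction.sub_apply] at h3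
      have h4 := abs_add_le (loopRhs G r c τ x (U c x) - loopRhs G r c τ x (U d x))
        (loopRhs G r c τ x (U d x) - loopRhs G r d τ x (U d x))
      rw [sub_add_sub_cancel] at h4
      linarith [hδ x (U d x)]
    exact (LipschitzWith.of_dist_le_mul (K := ⟨15 / 2 * (τ * L), by positivity⟩) hlip).continuous
  have happrox : ∀ c, |lam c - τ * (15 / 4 * ∫ x, decSol x * G (normalLoop x, c, 0))| ≤
      15 / 4 * (C * τ ^ 2) := by
    intro c
    have hball0 : ∀ x, (normalLoop x, (c : ℝ), (0 : ℝ)) ∈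
        Metric.closedBall (normalLoop x, c₀, (0 : ℝ)) r := fun x => by
      have := mem_closedBall_tube (k := normalLoop x) (a := 0) (by simpa using hr0.le) (hcr c)
        le_rfl hr0.le
      rwa [add_zero] at this
    have hk : Continuous fun x => τ * G (normalLoop x, (c : ℝ), (0 : ℝ)) :=
      (hG.continuousOn.comp_continuous (continuous_normalLoop.prodMk continuous_const)
        fun x => (hT _ (hx x) _ (hball0 x)).1).const_mul τ
    have hkB : ∀ x, |τ * G (normalLoop x, (c : ℝ), (0 : ℝ))| ≤ τ * B := fun x => by
      rw [abs_mul, abs_of_nonneg hτ]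
      exact mul_le_mul_of_nonneg_left (hT _ (hx x) _ (hball0 x)).2.1 hτ
    have e1 : τ * (15 / 4 * ∫ x, decSol x * G (normalLoop x, c, 0)) =
        multiplier fun x => τ * G (normalLoop x, (c : ℝ), (0 : ℝ)) := by
      rw [multiplier, mul_left_comm, ← integral_const_mul]
      simp only [mul_left_comm]
    rw [e1, hlam, ← multiplier_sub ((hN c).continuous_comp (U c)) hk
      ((hN c).abs_comp_le (U c)) hkB]
    refine abs_multiplier_le fun x => ?_
    have hUx : ‖U c x‖ ≤ 150 * (τ * B) := ((U c).norm_coe_le_norm x).trans (hUn c)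
    have hcl : clipPair r (U c x) = U c x := clipPair_eq_self (by linarith)
    have hball := mem_closedBall_tube (k := normalLoop x) (norm_clipPair_le hr0.le (U c x)) (hcr c)
      hτ hτr.le
    have h1 := (hT _ (hx x) _ hball).2.2 _ (hball0 x)
    have h2 : ‖(normalLoop x + clipPair r (U c x), (c : ℝ), τ)
        - (normalLoop x, (c : ℝ), (0 : ℝ))‖ ≤ (150 * B + 1) * τ := by
      rw [hcl]
      simp only [Prod.mk_sub_mk, add_sub_cancel_left, sub_zero, sub_self, Prod.norm_mk, norm_zero,
        Real.norm_eq_abs, abs_of_nonneg hτ]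
      have : 0 ≤ B * τ := by positivity
      refine max_le (by linarith) (max_le (by positivity) (by linarith))
    have h3 : |(U c x).1| ≤ 150 * (τ * B) := (le_max_left _ _).trans hUx
    have h4 : (U c x).1 ^ 2 ≤ (150 * (τ * B)) ^ 2 := sq_le_sq' (abs_le.1 h3).1 (abs_le.1 h3).2
    have h5 := mul_le_mul_of_nonneg_left (h1.trans (mul_le_mul_of_nonneg_left h2 hL0)) hτ
    have e2 : loopRhs G r c τ x (U c x) - τ * G (normalLoop x, (c : ℝ), (0 : ℝ)) =
        -2 * (U c x).1 ^ 2 + τ * (G (normalLoop x + clipPair r (U c x), (c : ℝ), τ)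
          - G (normalLoop x, (c : ℝ), (0 : ℝ))) := by
      simp only [loopRhs]; rw [hcl]; ring
    rw [e2]
    refine (abs_add_le _ _).trans ?_
    rw [abs_mul, abs_mul, abs_of_nonneg hτ, abs_neg, abs_two, abs_of_nonneg (sq_nonneg _), hC]
    nlinarith
  obtain ⟨c, hc⟩ : ∃ c, lam c = 0 := by
    have hQm : Q * |m'| = 2 * C := by rw [hQ]; field_simp
    refine exists_eq_zero_of_approx (k := τ * (15 / 4 * m')) (by positivity) hcont fun c => ?_
    have hcQ : |(c : ℝ) - c₀| ≤ Q * τ := abs_le.2 ⟨by linarith [c.2.1], by linarith [c.2.2]⟩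
    have h1 := mul_le_mul_of_nonneg_left (hη c (by linarith))
      (by positivity : 0 ≤ τ * (15 / 4))
    rw [← abs_of_nonneg (by positivity : 0 ≤ τ * (15 / 4)), ← abs_mul,
      abs_of_nonneg (by positivity : 0 ≤ τ * (15 / 4))] at h1
    have h2 := abs_add_le _ _ |>.trans (add_le_add (happrox c) h1)
    have h3 := mul_le_mul_of_nonneg_left hcQ (by positivity : 0 ≤ τ * (15 / 4) * (|m'| / 2))
    have e : |τ * (15 / 4 * m')| = τ * (15 / 4) * |m'| := by
      rw [abs_mul, abs_mul, abs_of_nonneg hτ, abs_of_pos (by norm_num : (0 : ℝ) < 15 / 4)]; ring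
    have e2 : lam c - τ * (15 / 4 * m') * (c - c₀) =
        lam c - τ * (15 / 4 * ∫ x, decSol x * G (normalLoop x, c, 0)) + τ * (15 / 4) *
          ((∫ x, decSol x * G (normalLoop x, c, 0)) - m' * (c - c₀)) := by ring
    rw [e, e2]
    refine h2.trans ?_
    have e3 : τ * (15 / 4) * |m'| * (Q * τ) = 15 / 4 * τ ^ 2 * (2 * C) := by rw [← hQm]; ring
    linarith
  -- At a zero of the bifurcation function the fixed point solves the unprojected equation.
  have hproj : proj (fun x => loopRhs G r c τ x (U c x)) = fun x => loopRhs G r c τ x (U c x) := by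
    funext x
    have hc' : multiplier (fun x => loopRhs G r c τ x (U c x)) = 0 := by rwa [hlam] at hc
    rw [proj, hc', zero_mul, sub_zero]
  have hUeq : ∀ x, U c x = (resU (fun x => loopRhs G r c τ x (U c x)) x,
      resV (fun x => loopRhs G r c τ x (U c x)) x) := fun x => by
    conv_lhs => rw [← hU c]
    rw [IsRightHandSide.solveMap_apply, res, hproj]
  have hUx : ∀ x, ‖U c x‖ ≤ 150 * (τ * B) := fun x => ((U c).norm_coe_le_norm x).trans (hUn c)
  have hcl : ∀ x, clipPair r (U c x) = U c x := fun x => clipPair_eq_self (by linarith [hUx x])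
  obtain ⟨l, hl0, hl1, hl2⟩ := IsRightHandSide.exists_tendsto_of_fixed le_rfl (hN c) (hU c)
  have hadd : ((-1, 0) : ℝ × ℝ) + (l, 0) = (-1 + l, 0) := by simp
  have hln : ‖((l, 0) : ℝ × ℝ)‖ ≤ r :=
    le_of_tendsto hl1.norm (Eventually.of_forall fun x => by linarith [hUx x])
  refine ⟨c, abs_le.2 ⟨by linarith [c.2.1], by linarith [c.2.2]⟩,
    fun x => normalLoop x + U c x, -1 + l, fun x => ?_, fun x => ?_, ?_, ?_, fun x => ?_, ?_, ?_⟩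
  · rw [add_sub_cancel_left]; linarith [hUx x]
  · exact (hT _ (hx x) _ (mem_closedBall_tube (by linarith [hUx x]) (hcr c) hτ hτr.le)).1
  · rw [← hadd]
    exact (hT _ saddle_mem_closure_normalLoop _ (mem_closedBall_tube hln (hcr c) hτ hτr.le)).1
  · rw [clipPair_eq_self hln, hadd] at hl0
    linear_combination hl0
  · have hc' := (hN c).continuous_comp (U c)
    have h1 := (hasDerivAt_resU hc' x).prodMk (hasDerivAt_resV hc' x)
    have h2 : HasDerivAt (U c) ((U c x).2, potential x * (U c x).1 + loopRhs G r c τ x (U c x))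
        x := by
      refine (h1.congr_of_eventuallyEq (Eventually.of_forall hUeq)).congr_deriv
        (Prod.ext (congrArg Prod.snd (hUeq x)).symm ?_)
      simp only
      rw [show (U c x).1 = resU (fun x => loopRhs G r c τ x (U c x)) x from
        congrArg Prod.fst (hUeq x)]
    refine ((hasDerivAt_normalLoop x).add h2).congr_deriv ?_
    simp only [loopRhs, hcl]
    ext
    · simp
    · simp only [Prod.snd_add, Prod.fst_add, normalLoop, potential]; ring
  · rw [← hadd]; exact tendsto_normalLoop_atTop.add hl1
  · rw [← hadd]; exact tendsto_normalLoop_atBot.add hl2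

/-! ### The Melnikov function in closed form and its zero -/

/-- The time scale `κ = ½ √(√Δ / c)` that normalizes the unperturbed loop. -/
noncomputable def rate (c g : ℝ) : ℝ := 1 / 2 * √(3 * √(disc c g) / (3 * c))

/-- The affine change of coordinates from the normalized phase plane `(w, dw/dx)` to `(φ, y)`:
`φ = c - 1 + √Δ w`, with time `x = κ ξ`. -/
noncomputable def toPlane (c g : ℝ) (q : ℝ × ℝ) : ℝ × ℝ :=
  (c - 1 + √(disc c g) * q.1, √(disc c g) * rate c g * q.2)

theorem loop_eq_toPlane (c g ξ : ℝ) : loop c g ξ = toPlane c g (normalLoop (rate c g * ξ)) := by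
  rw [loop_eq]
  simp only [toPlane, normalLoop, rate, rightPoint, decSol]
  ext <;> ring

theorem rate_eq (c g : ℝ) : rate c g = √(√(disc c g)) / (2 * √c) := by
  rw [rate, mul_div_mul_left _ _ (by norm_num : (3 : ℝ) ≠ 0), Real.sqrt_div (Real.sqrt_nonneg _)]
  ring

theorem rate_pos {c g : ℝ} (hc : 0 < c) (hD : 0 < disc c g) : 0 < rate c g := by
  rw [rate_eq]
  have := Real.sqrt_pos.2 (Real.sqrt_pos.2 hD)
  have := Real.sqrt_pos.2 hc
  positivity

theorem rate_sq {c g : ℝ} (hc : 0 < c) : rate c g ^ 2 = √(disc c g) / (4 * c) := by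
  rw [rate_eq, div_pow, mul_pow, Real.sq_sqrt (Real.sqrt_nonneg _), Real.sq_sqrt hc.le]
  norm_num

/-- `∫ (c - s w) y² = (4/15) (c - 5 s / 7)` along the normalized loop. -/
theorem integral_normalLoop_mul_decSol_sq (c s : ℝ) :
    Integrable (fun x => (c - s * (normalLoop x).1) * decSol x ^ 2) ∧
      ∫ x, (c - s * (normalLoop x).1) * decSol x ^ 2 = 4 / 15 * (c - 5 * s / 7) := by
  have hP : ∀ t : ℝ, HasDerivAt
      (fun t : ℝ => (c - 2 * s) * (t ^ 3 / 3) + (5 * s - c) * (t ^ 5 / 5) - 3 * s * (t ^ 7 / 7))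
      ((c - 2 * s) * t ^ 2 + (5 * s - c) * t ^ 4 - 3 * s * t ^ 6) t := fun t => by
    refine (((((hasDerivAt_pow 3 t).div_const 3).const_mul (c - 2 * s)).add
      (((hasDerivAt_pow 5 t).div_const 5).const_mul (5 * s - c))).sub
      (((hasDerivAt_pow 7 t).div_const 7).const_mul (3 * s))).congr_deriv ?_
    push_cast; ring
  have e : (fun x => (c - s * (normalLoop x).1) * decSol x ^ 2) = fun x =>
      ((c - 2 * s) * Real.tanh x ^ 2 + (5 * s - c) * Real.tanh x ^ 4 - 3 * s * Real.tanh x ^ 6)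
        * (1 - Real.tanh x ^ 2) := by
    funext x; simp only [normalLoop, decSol]; ring
  rw [e]
  obtain ⟨h1, h2⟩ := integral_comp_tanh_mul hP (by fun_prop)
  refine ⟨h1, h2.trans ?_⟩
  ring

theorem melnikovIntegrandKS_eq (c g : ℝ) (hc : c ≠ 0) : melnikovIntegrandKS c g = fun ξ =>
    -(36 * √(disc c g) ^ 2 * rate c g ^ 2 / c ^ 2) *
      ((c - √(disc c g) * (normalLoop (rate c g * ξ)).1) * decSol (rate c g * ξ) ^ 2) := by
  funext ξ
  simp only [melnikovIntegrandKS, loop_eq_toPlane, perturbationKS, toPlane]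
  generalize hx : rate c g * ξ = x
  simp only [normalLoop]
  field_simp
  ring

theorem integrable_melnikovIntegrandKS {c g : ℝ} (hc : 0 < c) (hD : 0 < disc c g) :
    Integrable (melnikovIntegrandKS c g) := by
  rw [melnikovIntegrandKS_eq c g hc.ne']
  exact ((integral_normalLoop_mul_decSol_sq c (√(disc c g))).1.comp_mul_left'
    (rate_pos hc hD).ne').const_mul _

theorem melnikovKS_eq_integral {c g : ℝ} (hc : 0 < c) (hD : 0 < disc c g) :
    melnikovKS c g = -(36 * √(disc c g) ^ 2 * rate c g / c ^ 2) *
      ∫ x, (c - √(disc c g) * (normalLoop x).1) * decSol x ^ 2 := by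
  have hk := rate_pos hc hD
  rw [melnikovKS, melnikovIntegrandKS_eq c g hc.ne', integral_const_mul,
    Measure.integral_comp_mul_left
      (fun x => (c - √(disc c g) * (normalLoop x).1) * decSol x ^ 2) (rate c g),
    abs_of_pos (inv_pos.2 hk), smul_eq_mul]
  field_simp

/-- The positive factor of the Melnikov function. -/
noncomputable def melnikovFactor (c g : ℝ) : ℝ :=
  8 / (35 * c ^ 2) * √(1 / c) * (√(disc c g) ^ 2 * √(√(disc c g)))

theorem melnikovKS_eq {c g : ℝ} (hc : 0 < c) (hD : 0 < disc c g) :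
    melnikovKS c g = melnikovFactor c g * (15 * √(disc c g) - 21 * c) := by
  have := Real.sqrt_pos.2 hc
  rw [melnikovKS_eq_integral hc hD, (integral_normalLoop_mul_decSol_sq c _).2, rate_eq,
    melnikovFactor, Real.sqrt_div zero_le_one, Real.sqrt_one]
  field_simp
  ring

theorem melnikovFactor_pos {c g : ℝ} (hc : 0 < c) (hD : 0 < disc c g) :
    0 < melnikovFactor c g := by
  have h1 := Real.sqrt_pos.2 hD
  have h2 := Real.sqrt_pos.2 h1
  have h3 := Real.sqrt_pos.2 (one_div_pos.2 hc)
  unfold melnikovFactor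
  positivity

theorem rpow_five_quarters {D : ℝ} (hD : 0 < D) : D ^ (5 / 4 : ℝ) = √D ^ 2 * √(√D) := by
  rw [Real.sq_sqrt hD.le, Real.sqrt_eq_rpow, Real.sqrt_eq_rpow, ← Real.rpow_mul hD.le]
  nth_rewrite 2 [← Real.rpow_one D]
  rw [← Real.rpow_add hD]
  norm_num

theorem melnikovKS_closed_form {c g : ℝ} (hc : 0 < c) (hD : 0 < disc c g) :
    melnikovKS c g =
      8 / (35 * c ^ 2) * √(1 / c) * (15 * √(c ^ 2 - 2 * c + 2 * g + 1) + 21 * c - 21) *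
          (c ^ 2 - 2 * c + 2 * g + 1) ^ (5 / 4 : ℝ)
        - 24 * (2 * c - 1) / (5 * c ^ 2) * √(1 / c) *
          (c ^ 2 - 2 * c + 2 * g + 1) ^ (5 / 4 : ℝ) := by
  have e : c ^ 2 - 2 * c + 2 * g + 1 = disc c g := by unfold disc; ring
  rw [e, rpow_five_quarters hD, melnikovKS_eq hc hD, melnikovFactor]
  field_simp
  ring

/-- The positive root of `24 c² + 50 c = 25 (2 g + 1)`, that is, of `25 Δ = 49 c²`. -/
noncomputable def melnikovZero (g : ℝ) : ℝ := (-25 + √(1225 + 1200 * g)) / 24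

theorem melnikovZero_pos {g : ℝ} (hg : -(1 / 2) < g) : 0 < melnikovZero g := by
  have : 25 < √(1225 + 1200 * g) := Real.lt_sqrt_of_sq_lt (by linarith)
  unfold melnikovZero
  linarith

theorem disc_melnikovZero {g : ℝ} (hg : -(1 / 2) < g) :
    disc (melnikovZero g) g = (7 / 5 * melnikovZero g) ^ 2 := by
  have h := Real.sq_sqrt (by linarith : (0 : ℝ) ≤ 1225 + 1200 * g)
  unfold disc melnikovZero
  linear_combination (-1 / 600) * h

theorem sqrt_disc_melnikovZero {g : ℝ} (hg : -(1 / 2) < g) :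
    √(disc (melnikovZero g) g) = 7 / 5 * melnikovZero g := by
  rw [disc_melnikovZero hg, Real.sqrt_sq (by linarith [melnikovZero_pos hg])]

theorem disc_melnikovZero_pos {g : ℝ} (hg : -(1 / 2) < g) : 0 < disc (melnikovZero g) g := by
  have := melnikovZero_pos hg
  rw [disc_melnikovZero hg]; positivity

theorem melnikovKS_eq_zero_iff {g c : ℝ} (hg : -(1 / 2) < g) (hc : 0 < c) (hD : 0 < disc c g) :
    melnikovKS c g = 0 ↔ c = melnikovZero g := by
  rw [melnikovKS_eq hc hD, mul_eq_zero, or_iff_right (melnikovFactor_pos hc hD).ne']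
  have h0 := melnikovZero_pos hg
  constructor
  · intro h
    have h1 : √(disc c g) = 7 / 5 * c := by linarith
    have h2 : disc c g = (7 / 5 * c) ^ 2 := by rw [← h1, Real.sq_sqrt hD.le]
    have h3 := disc_melnikovZero hg
    unfold disc at h2 h3
    have h4 : (c - melnikovZero g) * (24 * (c + melnikovZero g) + 50) = 0 := by
      linear_combination (-25) * h2 + 25 * h3
    have h5 : 24 * (c + melnikovZero g) + 50 ≠ 0 := by positivity
    linarith [(mul_eq_zero.1 h4).resolve_right h5]
  · rintro rfl
    rw [sqrt_disc_melnikovZero hg]; ring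

/-- The product rule at a zero of the second factor needs only continuity of the first. -/
theorem hasDerivAt_mul_of_eq_zero {A f : ℝ → ℝ} {f' c : ℝ} (hA : ContinuousAt A c)
    (hf : HasDerivAt f f' c) (h0 : f c = 0) : HasDerivAt (fun x => A x * f x) (A c * f') c := by
  rw [hasDerivAt_iff_tendsto_slope] at hf ⊢
  refine ((hA.tendsto.mono_left nhdsWithin_le_nhds).mul hf).congr fun x => ?_
  simp only [slope, h0, vsub_eq_sub, sub_zero, smul_eq_mul, mul_zero]
  ring

theorem hasDerivAt_disc (c g : ℝ) : HasDerivAt (fun c => disc c g) (2 * (c - 1)) c := by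
  refine ((((hasDerivAt_id c).sub_const 1).pow 2).add_const (2 * g)).congr_deriv ?_
  simp

theorem continuous_disc (g : ℝ) : Continuous fun c => disc c g := by unfold disc; fun_prop

theorem continuousAt_rate {c : ℝ} (hc : c ≠ 0) (g : ℝ) : ContinuousAt (fun c => rate c g) c := by
  have h := continuous_disc g
  have : 3 * c ≠ 0 := by simpa using hc
  unfold rate
  fun_prop (disch := assumption)

theorem eventually_pos_disc_pos {c g : ℝ} (hc : 0 < c) (hD : 0 < disc c g) :
    ∀ᶠ x in 𝓝 c, 0 < x ∧ 0 < disc x g :=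
  (lt_mem_nhds hc).and ((continuous_disc g).continuousAt.eventually (lt_mem_nhds hD))

/-- The zero of the Melnikov function is simple, with an explicit derivative. -/
theorem hasDerivAt_melnikovKS {g : ℝ} (hg : -(1 / 2) < g) :
    HasDerivAt (fun c => melnikovKS c g) (melnikovFactor (melnikovZero g) g *
      (-(72 / 7 * melnikovZero g + 75 / 7) / melnikovZero g)) (melnikovZero g) := by
  have hc := melnikovZero_pos hg
  have hD := disc_melnikovZero_pos hg
  have hs := sqrt_disc_melnikovZero hg
  have h1 : HasDerivAt (fun c => 15 * √(disc c g) - 21 * c)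
      (-(72 / 7 * melnikovZero g + 75 / 7) / melnikovZero g) (melnikovZero g) := by
    refine ((((hasDerivAt_disc _ g).sqrt hD.ne').const_mul 15).sub
      ((hasDerivAt_id _).const_mul 21)).congr_deriv ?_
    rw [hs]
    field_simp
    ring
  have hA : ContinuousAt (fun c => melnikovFactor c g) (melnikovZero g) := by
    have h := continuous_disc g
    have h1 : 35 * melnikovZero g ^ 2 ≠ 0 := by positivity
    have h2 : melnikovZero g ≠ 0 := hc.ne'
    unfold melnikovFactor
    fun_prop (disch := assumption)
  refine (hasDerivAt_mul_of_eq_zero hA h1 (by rw [hs]; ring)).congr_of_eventuallyEq ?_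
  filter_upwards [eventually_pos_disc_pos hc hD] with x hx
  exact melnikovKS_eq hx.1 hx.2

theorem exists_hasDerivAt_melnikovKS {g : ℝ} (hg : -(1 / 2) < g) :
    ∃ m' ≠ 0, HasDerivAt (fun c => melnikovKS c g) m' (melnikovZero g) := by
  refine ⟨_, ?_, hasDerivAt_melnikovKS hg⟩
  have hc := melnikovZero_pos hg
  refine mul_ne_zero (melnikovFactor_pos hc (disc_melnikovZero_pos hg)).ne'
    (div_ne_zero (neg_ne_zero.2 ?_) hc.ne')
  positivity

/-! ### Homoclinic orbits of the slow system -/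

/-- A solution of an autonomous system that passes through an equilibrium is constant. -/
theorem eq_of_solves_of_eq {E : Type*} [NormedAddCommGroup E] [NormedSpace ℝ E] {V : E → E} {p : E}
    (hV : ContDiffAt ℝ 1 V p) (hp : V p = 0) {X : ℝ → E} (hX : ∀ ξ, HasDerivAt X (V (X ξ)) ξ)
    {ξ₀ : ℝ} (h0 : X ξ₀ = p) (ξ : ℝ) : X ξ = p := by
  have hXc : Continuous X := continuous_iff_continuousAt.2 fun ξ => (hX ξ).continuousAt
  obtain ⟨K, s, hs, hK⟩ := hV.exists_lipschitzOnWith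
  have hopen : IsOpen (X ⁻¹' {p}) := isOpen_iff_mem_nhds.2 fun t ht => by
    have ht' : X t = p := ht
    have hev : ∀ᶠ r in 𝓝 t, HasDerivAt X (V (X r)) r ∧ X r ∈ s :=
      (hXc.continuousAt.eventually_mem (by rwa [ht'])).mono fun r hr => ⟨hX r, hr⟩
    refine ODE_solution_unique_of_eventually (v := fun _ => V) (s := fun _ => s) (K := K)
      (Eventually.of_forall fun _ => hK) hev (g := fun _ => p)
      (Eventually.of_forall fun r => ⟨?_, mem_of_mem_nhds hs⟩) ht'
    rw [hp]; exact hasDerivAt_const r p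
  have huniv := IsClopen.eq_univ ⟨isClosed_singleton.preimage hXc, hopen⟩ ⟨ξ₀, h0⟩
  have : ξ ∈ X ⁻¹' {p} := by rw [huniv]; trivial
  exact this

/-- The coordinate change on the extended phase space of points `(w, w', c, τ)`. -/
noncomputable def toPlaneExt (g : ℝ) (p : (ℝ × ℝ) × ℝ × ℝ) : (ℝ × ℝ) × ℝ × ℝ :=
  (toPlane p.2.1 g p.1, p.2.1, p.2.2)

/-- The parameters `c` for which the unperturbed system has the homoclinic loop, as a subset of the
extended phase space. -/
def loopRegion (g : ℝ) : Set ((ℝ × ℝ) × ℝ × ℝ) := {p | 0 < p.2.1 ∧ 0 < disc p.2.1 g}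

/-- The perturbation term of the slow system in the normalized coordinates, where the system reads
`w'' = 2 (1 - w²) + τ G (w, w', c, τ)`. -/
noncomputable def normalPert (R : (ℝ × ℝ) × ℝ × ℝ → ℝ) (g : ℝ) (p : (ℝ × ℝ) × ℝ × ℝ) : ℝ :=
  4 * p.2.1 / disc p.2.1 g *
    (perturbationKS p.2.1 (toPlane p.2.1 g p.1) + p.2.2 * R (toPlaneExt g p))

theorem isOpen_loopRegion (g : ℝ) : IsOpen (loopRegion g) := by
  have h1 : Continuous fun p : (ℝ × ℝ) × ℝ × ℝ => p.2.1 := by fun_prop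
  exact (isOpen_lt continuous_const h1).inter
    (isOpen_lt continuous_const ((continuous_disc g).comp h1))

theorem contDiffOn_toPlane (g : ℝ) :
    ContDiffOn ℝ 1 (fun p : (ℝ × ℝ) × ℝ × ℝ => toPlane p.2.1 g p.1) (loopRegion g) := by
  have hc : ContDiffOn ℝ 1 (fun p : (ℝ × ℝ) × ℝ × ℝ => p.2.1) (loopRegion g) := by fun_prop
  have hs : ContDiffOn ℝ 1 (fun p : (ℝ × ℝ) × ℝ × ℝ => √(disc p.2.1 g)) (loopRegion g) := by
    refine ContDiffOn.sqrt ?_ fun p hp => hp.2.ne'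
    unfold disc
    fun_prop
  have hk : ContDiffOn ℝ 1 (fun p : (ℝ × ℝ) × ℝ × ℝ => rate p.2.1 g) (loopRegion g) := by
    have h3 : ∀ p ∈ loopRegion g, (3 : ℝ) * p.2.1 ≠ 0 := fun p hp =>
      mul_ne_zero three_ne_zero hp.1.ne'
    refine contDiffOn_const.mul (ContDiffOn.sqrt
      ((contDiffOn_const.mul hs).div (contDiffOn_const.mul hc) h3) fun p hp => ?_)
    have := Real.sqrt_pos.2 hp.2
    exact div_ne_zero (by positivity) (h3 p hp)
  have h1 : ContDiffOn ℝ 1 (fun p : (ℝ × ℝ) × ℝ × ℝ => p.1.1) (loopRegion g) := by fun_prop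
  have h2 : ContDiffOn ℝ 1 (fun p : (ℝ × ℝ) × ℝ × ℝ => p.1.2) (loopRegion g) := by fun_prop
  exact ((hc.sub contDiffOn_const).add (hs.mul h1)).prodMk ((hs.mul hk).mul h2)

theorem contDiffOn_toPlaneExt (g : ℝ) : ContDiffOn ℝ 1 (toPlaneExt g) (loopRegion g) :=
  (contDiffOn_toPlane g).prodMk contDiff_snd.contDiffOn

theorem contDiffOn_normalPert {R : (ℝ × ℝ) × ℝ × ℝ → ℝ} {U : Set ((ℝ × ℝ) × ℝ × ℝ)} (g : ℝ)
    (hR : ContDiffOn ℝ 1 R U) :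
    ContDiffOn ℝ 1 (normalPert R g) (loopRegion g ∩ toPlaneExt g ⁻¹' U) := by
  have hsub : loopRegion g ∩ toPlaneExt g ⁻¹' U ⊆ loopRegion g := Set.inter_subset_left
  have hc : ContDiffOn ℝ 1 (fun p : (ℝ × ℝ) × ℝ × ℝ => p.2.1)
      (loopRegion g ∩ toPlaneExt g ⁻¹' U) := by fun_prop
  have hd : ContDiffOn ℝ 1 (fun p : (ℝ × ℝ) × ℝ × ℝ => disc p.2.1 g)
      (loopRegion g ∩ toPlaneExt g ⁻¹' U) := by unfold disc; fun_prop
  have hq := (contDiffOn_toPlane g).mono hsub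
  have hRc := hR.comp ((contDiffOn_toPlaneExt g).mono hsub) fun p hp => hp.2
  have h1 : ContDiffOn ℝ 1 (fun p : (ℝ × ℝ) × ℝ × ℝ => (toPlane p.2.1 g p.1).1)
      (loopRegion g ∩ toPlaneExt g ⁻¹' U) := hq.fst
  have h2 : ContDiffOn ℝ 1 (fun p : (ℝ × ℝ) × ℝ × ℝ => (toPlane p.2.1 g p.1).2)
      (loopRegion g ∩ toPlaneExt g ⁻¹' U) := hq.snd
  have hne : ∀ p ∈ loopRegion g ∩ toPlaneExt g ⁻¹' U, p.2.1 ≠ 0 := fun p hp => hp.1.1.ne'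
  have hP : ContDiffOn ℝ 1 (fun p : (ℝ × ℝ) × ℝ × ℝ => perturbationKS p.2.1 (toPlane p.2.1 g p.1))
      (loopRegion g ∩ toPlaneExt g ⁻¹' U) :=
    ((contDiffOn_const.div hc hne).mul
      (((((contDiffOn_const.mul hc).sub contDiffOn_const).div hc hne).mul h2).sub
        ((contDiffOn_const.div hc hne).mul (h1.mul h2)))).neg
  exact ((contDiffOn_const.mul hc).div hd fun p hp => hp.1.2.ne').mul
    (hP.add ((contDiff_snd.comp contDiff_snd).contDiffOn.mul hRc))

/-- The Melnikov integral of the normalized equation is a nonvanishing multiple of `melnikovKS`. -/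
theorem integral_decSol_mul_normalPert (R : (ℝ × ℝ) × ℝ × ℝ → ℝ) {c g : ℝ} (hc : 0 < c)
    (hD : 0 < disc c g) : ∫ x, decSol x * normalPert R g (normalLoop x, c, 0) =
      -(2 * c / (3 * disc c g * √(disc c g))) * melnikovKS c g := by
  have hs := Real.sqrt_pos.2 hD
  have hss := Real.sq_sqrt hD.le
  rw [melnikovKS_eq_integral hc hD, ← mul_assoc, ← integral_const_mul]
  congr 1
  funext x
  simp only [normalPert, perturbationKS, toPlane, toPlaneExt, normalLoop]
  rw [← hss]
  field_simp
  ring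

/-- The slow vector field in the normalized coordinates. -/
theorem slowFieldKS_toPlane (R : (ℝ × ℝ) × ℝ × ℝ → ℝ) {c g : ℝ} (hc : 0 < c)
    (hD : 0 < disc c g) (τ : ℝ) (q : ℝ × ℝ) :
    slowFieldKS R c g τ (toPlane c g q) = (√(disc c g) * rate c g * q.2,
      √(disc c g) * rate c g ^ 2 * (2 * (1 - q.1 ^ 2) + τ * normalPert R g (q, c, τ))) := by
  have hss := Real.sq_sqrt hD.le
  have hs := Real.sqrt_pos.2 hD
  have hg : g = (√(disc c g) ^ 2 - (c - 1) ^ 2) / 2 := by rw [hss]; unfold disc; ring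
  rw [rate_sq hc]
  simp only [slowFieldKS, normalPert, toPlaneExt]
  ext
  · rfl
  · simp only
    generalize R (toPlane c g q, c, τ) = ρ
    generalize hP : perturbationKS c (toPlane c g q) = P
    rw [show disc c g = √(disc c g) ^ 2 from hss.symm]
    simp only [Real.sqrt_sq hs.le, toPlane]
    generalize √(disc c g) = s at *
    rw [hg]
    field_simp
    ring

theorem hasDerivAt_toPlane_comp (R : (ℝ × ℝ) × ℝ × ℝ → ℝ) {c g : ℝ} (hc : 0 < c)
    (hD : 0 < disc c g) {τ : ℝ} {Y : ℝ → ℝ × ℝ}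
    (hY : ∀ x, HasDerivAt Y
      ((Y x).2, 2 * (1 - (Y x).1 ^ 2) + τ * normalPert R g (Y x, c, τ)) x) (ξ : ℝ) :
    HasDerivAt (fun ξ => toPlane c g (Y (rate c g * ξ)))
      (slowFieldKS R c g τ (toPlane c g (Y (rate c g * ξ)))) ξ := by
  rw [slowFieldKS_toPlane R hc hD]
  have h0 : HasDerivAt (fun ξ : ℝ => rate c g * ξ) (rate c g) ξ := by
    simpa using (hasDerivAt_id ξ).const_mul (rate c g)
  have h1 := (hY (rate c g * ξ)).scomp ξ h0
  have hf := hasFDerivAt_fst.comp_hasDerivAt ξ h1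
  have hs := hasFDerivAt_snd.comp_hasDerivAt ξ h1
  refine (((hf.const_mul (√(disc c g))).const_add (c - 1)).prodMk
    (hs.const_mul (√(disc c g) * rate c g))).congr_deriv ?_
  simp only [Prod.smul_mk, smul_eq_mul, ContinuousLinearMap.coe_fst', ContinuousLinearMap.coe_snd']
  ext <;> simp only <;> ring

theorem continuous_toPlane (c g : ℝ) : Continuous (toPlane c g) := by unfold toPlane; fun_prop

theorem Gam_eq {c g : ℝ} (hk : rate c g ≠ 0) :
    Gam c g = Set.range fun x => toPlane c g (normalLoop x) := by
  ext q
  constructor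
  · rintro ⟨ξ, rfl⟩
    exact ⟨rate c g * ξ, (loop_eq_toPlane c g ξ).symm⟩
  · rintro ⟨x, rfl⟩
    exact ⟨x / rate c g, by rw [loop_eq_toPlane, mul_div_cancel₀ _ hk]⟩

theorem dist_toPlane_le {c c₀ g d : ℝ} {a b : ℝ × ℝ} (hab : ‖a - b‖ ≤ d) (hb : ‖b‖ ≤ 6) :
    dist (toPlane c g a) (toPlane c₀ g b) ≤ |c - c₀| + (|√(disc c g)| * d
      + |√(disc c g) - √(disc c₀ g)| * 6) + (|√(disc c g) * rate c g| * d
      + |√(disc c g) * rate c g - √(disc c₀ g) * rate c₀ g| * 6) := by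
  have key : ∀ {s s₀ u v : ℝ}, |u - v| ≤ d → |v| ≤ 6 →
      |s * u - s₀ * v| ≤ |s| * d + |s - s₀| * 6 := fun {s s₀ u v} h1 h2 => by
    have e : s * u - s₀ * v = s * (u - v) + (s - s₀) * v := by ring
    rw [e]
    refine (abs_add_le _ _).trans ?_
    rw [abs_mul, abs_mul]
    exact add_le_add (mul_le_mul_of_nonneg_left h1 (abs_nonneg _))
      (mul_le_mul_of_nonneg_left h2 (abs_nonneg _))
  have hd : 0 ≤ d := (norm_nonneg _).trans hab
  have k1 := key (s := √(disc c g)) (s₀ := √(disc c₀ g)) (u := a.1) (v := b.1)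
    ((le_max_left _ _).trans hab) ((le_max_left _ _).trans hb)
  have k2 := key (s := √(disc c g) * rate c g) (s₀ := √(disc c₀ g) * rate c₀ g)
    (u := a.2) (v := b.2) ((le_max_right _ _).trans hab) ((le_max_right _ _).trans hb)
  rw [dist_eq_norm]
  refine max_le ?_ ?_
  · have e : (toPlane c g a - toPlane c₀ g b).1 =
        (c - c₀) + (√(disc c g) * a.1 - √(disc c₀ g) * b.1) := by
      simp only [toPlane, Prod.fst_sub]; ring
    rw [e, Real.norm_eq_abs]
    have h3 := abs_add_le (c - c₀) (√(disc c g) * a.1 - √(disc c₀ g) * b.1)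
    have : 0 ≤ |√(disc c g) * rate c g| * d
      + |√(disc c g) * rate c g - √(disc c₀ g) * rate c₀ g| * 6 := by positivity
    linarith
  · refine k2.trans ?_
    have : 0 ≤ |c - c₀| + (|√(disc c g)| * d + |√(disc c g) - √(disc c₀ g)| * 6) := by
      positivity
    linarith

/-- The transfer of a homoclinic solution of the normalized equation to the slow system. -/
theorem isHomoclinicOrbit_toPlane {R : (ℝ × ℝ) × ℝ × ℝ → ℝ} {U : Set ((ℝ × ℝ) × ℝ × ℝ)}
    (hU : IsOpen U) (hR : ContDiffOn ℝ 1 R U) {c g τ d l : ℝ} (hc : 0 < c) (hD : 0 < disc c g)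
    {Y : ℝ → ℝ × ℝ} (hd : d ≤ 1) (hYd : ∀ x, ‖Y x - normalLoop x‖ ≤ d)
    (hYU : ∀ x, toPlaneExt g (Y x, c, τ) ∈ U) (hlU : toPlaneExt g ((l, 0), c, τ) ∈ U)
    (hl : 2 * (1 - l ^ 2) + τ * normalPert R g ((l, 0), c, τ) = 0)
    (hY : ∀ x, HasDerivAt Y
      ((Y x).2, 2 * (1 - (Y x).1 ^ 2) + τ * normalPert R g (Y x, c, τ)) x)
    (htop : Tendsto Y atTop (𝓝 (l, 0))) (hbot : Tendsto Y atBot (𝓝 (l, 0))) :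
    IsHomoclinicOrbit (slowFieldKS R c g τ) {q | (q, c, τ) ∈ U} (toPlane c g (l, 0))
      fun ξ => toPlane c g (Y (rate c g * ξ)) := by
  have hk := rate_pos hc hD
  have hlim := (continuous_toPlane c g).tendsto (l, 0)
  have heq : slowFieldKS R c g τ (toPlane c g (l, 0)) = 0 := by
    rw [slowFieldKS_toPlane R hc hD, hl]; simp
  have hsol := hasDerivAt_toPlane_comp R hc hD hY
  refine ⟨hlU, heq, fun ξ => hYU _, hsol, fun ξ hξ => ?_,
    hlim.comp (hbot.comp (tendsto_id.const_mul_atBot hk)),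
    hlim.comp (htop.comp (tendsto_id.const_mul_atTop hk))⟩
  -- The orbit is not constant, since `w` is close to `2` at time `0` and to `-1` at infinity.
  have hV : ContDiffAt ℝ 1 (slowFieldKS R c g τ) (toPlane c g (l, 0)) := by
    have hR' : ContDiffAt ℝ 1 (fun q : ℝ × ℝ => R (q, c, τ)) (toPlane c g (l, 0)) :=
      ContDiffAt.comp (g := R) (f := fun q : ℝ × ℝ => (q, c, τ)) _
        (hR.contDiffAt (hU.mem_nhds hlU)) (by fun_prop)
    have hpoly : ContDiff ℝ 1 fun q : ℝ × ℝ =>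
        1 / c * ((c - 1) * q.1 - 1 / 2 * q.1 ^ 2 + g) + τ * perturbationKS c q := by
      unfold perturbationKS
      fun_prop
    exact contDiffAt_snd.prodMk (hpoly.contDiffAt.add (contDiffAt_const.mul hR'))
  have h0 := eq_of_solves_of_eq hV heq hsol hξ 0
  have h1 := congrArg Prod.fst h0
  simp only [toPlane, mul_zero] at h1
  have h2 : (Y 0).1 = l :=
    mul_left_cancel₀ (Real.sqrt_pos.2 hD).ne' (add_left_cancel h1)
  have h3 := abs_le.1 ((le_max_left _ _).trans (hYd 0) : |(Y 0 - normalLoop 0).1| ≤ d)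
  have h4 : ‖((l, 0) : ℝ × ℝ) - (-1, 0)‖ ≤ d :=
    le_of_tendsto (htop.sub tendsto_normalLoop_atTop).norm (Eventually.of_forall hYd)
  have h5 := abs_le.1 ((le_max_left _ _).trans h4 : |l - -1| ≤ d)
  simp only [Prod.fst_sub, normalLoop, Real.tanh_zero] at h3
  linarith [h3.1, h5.2]

/-- The bifurcation of homoclinic orbits from a loop at which the Melnikov function has a simple
zero. -/
theorem exists_homoclinicOrbit_slowFieldKS {c₀ g m' : ℝ} (hc : 0 < c₀) (hD : 0 < disc c₀ g)
    (hM0 : melnikovKS c₀ g = 0) (hM : HasDerivAt (fun c => melnikovKS c g) m' c₀) (hm' : m' ≠ 0)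
    {U : Set ((ℝ × ℝ) × ℝ × ℝ)} {R : (ℝ × ℝ) × ℝ × ℝ → ℝ} (hU : IsOpen U)
    (hΓ : ∀ q ∈ closure (Gam c₀ g), (q, c₀, (0 : ℝ)) ∈ U) (hR : ContDiffOn ℝ 1 R U) :
    ∃ (c : ℝ → ℝ) (X : ℝ → ℝ → ℝ × ℝ),
      (fun τ => c τ - c₀) =O[𝓝[>] 0] (fun τ => τ) ∧
      (∀ᶠ τ in 𝓝[>] (0 : ℝ), ∃ p : ℝ × ℝ,
        IsHomoclinicOrbit (slowFieldKS R (c τ) g τ) {q | (q, c τ, τ) ∈ U} p (X τ)) ∧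
      Tendsto (fun τ => Metric.hausdorffEDist (Set.range (X τ)) (Gam c₀ g)) (𝓝[>] 0) (𝓝 0) := by
  have hk := rate_pos hc hD
  have hs := Real.sqrt_pos.2 hD
  have hev := eventually_pos_disc_pos hc hD
  have hW : IsOpen (loopRegion g ∩ toPlaneExt g ⁻¹' U) :=
    (contDiffOn_toPlaneExt g).continuousOn.isOpen_inter_preimage (isOpen_loopRegion g) hU
  have hK : ∀ k ∈ closure (Set.range normalLoop),
      (k, c₀, (0 : ℝ)) ∈ loopRegion g ∩ toPlaneExt g ⁻¹' U := fun k hkk => by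
    refine ⟨⟨hc, hD⟩, hΓ _ ?_⟩
    rw [Gam_eq hk.ne']
    have h := image_closure_subset_closure_image (continuous_toPlane c₀ g)
      (Set.mem_image_of_mem (toPlane c₀ g) hkk)
    rwa [← Set.range_comp] at h
  have hfac : ContinuousAt (fun c => -(2 * c / (3 * disc c g * √(disc c g)))) c₀ := by
    have h := continuous_disc g
    have h1 : 3 * disc c₀ g * √(disc c₀ g) ≠ 0 := by positivity
    fun_prop (disch := assumption)
  have hm : HasDerivAt (fun c => ∫ x, decSol x * normalPert R g (normalLoop x, c, 0))
      (-(2 * c₀ / (3 * disc c₀ g * √(disc c₀ g))) * m') c₀ :=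
    (hasDerivAt_mul_of_eq_zero hfac hM hM0).congr_of_eventuallyEq
      (hev.mono fun x hx => integral_decSol_mul_normalPert R hx.1 hx.2)
  obtain ⟨Q, A, hQA⟩ := exists_homoclinic_normalized hW (contDiffOn_normalPert g hR) hK
    (by rw [integral_decSol_mul_normalPert R hc hD, hM0, mul_zero]) hm
    (mul_ne_zero (neg_ne_zero.2 (by positivity)) hm')
  obtain ⟨c, hcQ⟩ := hQA.choice
  have hO : (fun τ => c τ - c₀) =O[𝓝[>] 0] (fun τ => τ) := by
    refine Asymptotics.IsBigO.of_bound Q ?_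
    filter_upwards [hcQ, self_mem_nhdsWithin] with τ h hτ
    rw [Real.norm_eq_abs, Real.norm_eq_abs, abs_of_pos (show (0 : ℝ) < τ from hτ)]
    exact h.1
  have hid : Tendsto (fun τ : ℝ => τ) (𝓝[>] 0) (𝓝 0) := tendsto_id.mono_left nhdsWithin_le_nhds
  have hct : Tendsto c (𝓝[>] 0) (𝓝 c₀) := by
    simpa using (hO.trans_tendsto hid).add_const c₀
  have hAt : Tendsto (fun τ => A * τ) (𝓝[>] 0) (𝓝 0) := by simpa using hid.const_mul A
  obtain ⟨Y, hY⟩ := (hcQ.mono fun τ h => h.2).choice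
  refine ⟨c, fun τ ξ => toPlane (c τ) g (Y τ (rate (c τ) g * ξ)), hO, ?_, ?_⟩
  · filter_upwards [hY, hct.eventually hev, (tendsto_order.1 hAt).2 1 one_pos]
      with τ ⟨l, h1, h2, h3, h4, h5, h6, h7⟩ hcτ hA1
    exact ⟨_, isHomoclinicOrbit_toPlane hU hR hcτ.1 hcτ.2 hA1.le h1 (fun x => (h2 x).2) h3.2 h4 h5
      h6 h7⟩
  · have hsc : ContinuousAt (fun c => √(disc c g)) c₀ :=
      (continuous_disc g).sqrt.continuousAt
    have hs1 := hsc.tendsto.comp hct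
    have hs2 := (hsc.mul (continuousAt_rate hc.ne' g)).tendsto.comp hct
    have hδ : Tendsto (fun τ => |c τ - c₀| + (|√(disc (c τ) g)| * (A * τ)
        + |√(disc (c τ) g) - √(disc c₀ g)| * 6) + (|√(disc (c τ) g) * rate (c τ) g| * (A * τ)
        + |√(disc (c τ) g) * rate (c τ) g - √(disc c₀ g) * rate c₀ g| * 6)) (𝓝[>] 0) (𝓝 0) := by
      have t := ((hct.sub_const c₀).abs.add ((hs1.abs.mul hAt).add
        ((hs1.sub_const (√(disc c₀ g))).abs.mul_const 6))).add ((hs2.abs.mul hAt).add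
        ((hs2.sub_const (√(disc c₀ g) * rate c₀ g)).abs.mul_const 6))
      simpa using t
    have hδ' := ENNReal.tendsto_ofReal hδ
    rw [ENNReal.ofReal_zero] at hδ'
    refine tendsto_of_tendsto_of_tendsto_of_le_of_le' tendsto_const_nhds hδ'
      (Eventually.of_forall fun _ => bot_le) ?_
    filter_upwards [hY, hct.eventually hev] with τ ⟨l, h1, _⟩ hcτ
    have hkτ := rate_pos hcτ.1 hcτ.2
    rw [Gam_eq hk.ne']
    refine Metric.hausdorffEDist_le_of_mem_edist ?_ ?_
    · rintro _ ⟨ξ, rfl⟩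
      refine ⟨_, ⟨rate (c τ) g * ξ, rfl⟩, ?_⟩
      rw [edist_dist]
      exact ENNReal.ofReal_le_ofReal (dist_toPlane_le (h1 _) (norm_normalLoop_le _))
    · rintro _ ⟨x, rfl⟩
      refine ⟨_, ⟨x / rate (c τ) g, rfl⟩, ?_⟩
      rw [edist_comm, edist_dist]
      simp only [mul_div_cancel₀ _ hkτ.ne']
      exact ENNReal.ofReal_le_ofReal (dist_toPlane_le (h1 _) (norm_normalLoop_le _))

end RLW

theorem mainTheorem3 :
    (∀ g c : ℝ, 0 < c → -2 * g < (c - 1) ^ 2 →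
      Integrable (RLW.melnikovIntegrandKS c g) ∧
      RLW.melnikovKS c g =
        8 / (35 * c ^ 2) * √(1 / c) * (15 * √(c ^ 2 - 2 * c + 2 * g + 1) + 21 * c - 21) *
            (c ^ 2 - 2 * c + 2 * g + 1) ^ (5 / 4 : ℝ)
          - 24 * (2 * c - 1) / (5 * c ^ 2) * √(1 / c) *
            (c ^ 2 - 2 * c + 2 * g + 1) ^ (5 / 4 : ℝ)) ∧
    ∃ c₀ : ℝ → ℝ, ∀ g : ℝ, -(1 / 2 : ℝ) < g →
      (0 < c₀ g ∧ -2 * g < (c₀ g - 1) ^ 2) ∧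
      (∀ c : ℝ, 0 < c → -2 * g < (c - 1) ^ 2 → (RLW.melnikovKS c g = 0 ↔ c = c₀ g)) ∧
      deriv (fun c => RLW.melnikovKS c g) (c₀ g) ≠ 0 ∧
      ∀ (U : Set ((ℝ × ℝ) × ℝ × ℝ)) (R : (ℝ × ℝ) × ℝ × ℝ → ℝ),
        IsOpen U → (∀ q ∈ closure (RLW.Gam (c₀ g) g), (q, c₀ g, 0) ∈ U) →
        ContDiffOn ℝ 1 R U →
        ∃ (c : ℝ → ℝ) (X : ℝ → ℝ → ℝ × ℝ),
          (fun τ => c τ - c₀ g) =O[𝓝[>] 0] (fun τ => τ) ∧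
          (∀ᶠ τ in 𝓝[>] (0 : ℝ), ∃ p : ℝ × ℝ,
            RLW.IsHomoclinicOrbit (RLW.slowFieldKS R (c τ) g τ)
              {q | (q, c τ, τ) ∈ U} p (X τ)) ∧
          Tendsto (fun τ => Metric.hausdorffEDist (Set.range (X τ)) (RLW.Gam (c₀ g) g))
            (𝓝[>] 0) (𝓝 0) := by
  have hdisc : ∀ {g c : ℝ}, -2 * g < (c - 1) ^ 2 → 0 < RLW.disc c g := fun {g c} h => by
    unfold RLW.disc; linarith
  refine ⟨fun g c hc h => ⟨RLW.integrable_melnikovIntegrandKS hc (hdisc h),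
    RLW.melnikovKS_closed_form hc (hdisc h)⟩, RLW.melnikovZero, fun g hg => ?_⟩
  have hc := RLW.melnikovZero_pos hg
  have hD := RLW.disc_melnikovZero_pos hg
  obtain ⟨m', hm', hM⟩ := RLW.exists_hasDerivAt_melnikovKS hg
  refine ⟨⟨hc, ?_⟩, fun c hc' h => RLW.melnikovKS_eq_zero_iff hg hc' (hdisc h), ?_,
    fun U R hU hΓ hR => RLW.exists_homoclinicOrbit_slowFieldKS hc hD
      ((RLW.melnikovKS_eq_zero_iff hg hc hD).2 rfl) hM hm' hU hΓ hR⟩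
  · have h := hD
    unfold RLW.disc at h
    linarith
  · rwa [hM.deriv]
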